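/- **Model.** For the security parameter $\kappa$ the universe is $U_\kappa=\{0,1\}^\kappa$. Time is the number of steps of a probabilistic (oracle) program in a fixed step-counting model; the time of adversaries and distinguishers includes their code length. Honest algorithms are uniform and polynomial-time in $\kappa$. Polynomial-time adversaries and distinguishers are probabilistic and non-uniform: sequences of programs of polynomially bounded time (for every behaviour of the oracle). A *pseudo-random permutation* (PRP) is a polynomial-time computable family of permutations $E_{sk}$ of $\{0,1\}^\kappa$, with keys $sk\in\{0,1\}^\kappa$, such that no polynomial-time distinguisher with oracle access to a permutation tells $E_{sk}$ ($sk$ uniform) from a uniformly random permutation with non-negligible advantage. An *$(n,\varepsilon)$-insertable Bloom filter* consists of polynomial-time algorithms $\mathbf B_1$ (build), $\mathbf B_2$ (query), $\mathbf B_3$ (insert) such that for all $S$ with $|S|=n$: $\Pr[\mathbf B_2(\mathbf B_1(S),x)=1]$ is $1$ for $x\in S$ and at most $\varepsilon$ for $x\notin S$; an inserted element is answered $1$; an element answered $1$ is still answered $1$ after any insertions; and an insertion never decreases the probability that an element is answered $1$. *AB and BP tests.* $\mathcal A_1$ picks $S$ with $|S|=n$, $M\leftarrow\mathbf B_1(S)$,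 and $\mathcal A_2(S)$ makes at most $t=t(\kappa)$ adaptive queries to $\mathbf B_2(M,\cdot)$. In the AB test it returns $x^*$ outside $S$ and its queries and wins iff $\mathbf B_2(M,x^*)=1$; $(n,t,\varepsilon)$-AB resilience: every polynomial-time adversary wins with probability at most $\varepsilon+\mathrm{negl}(\kappa)$. In the BP test it returns $(b,x^*)$ and its profit is $0$ if $b=0$, and if $b=1$ it is $1/\varepsilon$ when $x^*$ is a false positive and $-1/(1-\varepsilon)$ otherwise; $(n,t,\varepsilon)$-BP resilience: every polynomial-time adversary has expected profit at most $\mathrm{negl}(\kappa)$. (Runs against the rules count as lost, respectively as a pass.) *Filić correctness.* $\mathcal A_1$ picks a set $S$; $\mathcal A_2(S)$ has oracles for queries, for insertions, and for revealing the current representation, and its output goes to a distinguisher $\mathcal D$, which outputs a bit. In the real world the oracles are those of the filter. In the ideal world they are those of a simulator that keeps an array of the same length $m$ in which each element of $S$ and each inserted element sets $k$ positions given by a truly random function; that answers a query by $1$ for inserted elements and earlier false positives and otherwise by whether $k$ fresh uniform positions of the array are all set; and that reveals its array. If representations also contain auxiliary data (such as a key), the simulator presents auxiliary data drawn in the beginning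 from a distribution of its choice. The filter is $(q_u,q_t,q_v,t_a,t_s,t_d,\varepsilon')$-*Filić-correct* at $\kappa$ if, for some such distribution, the probabilities that $\mathcal D$ outputs $1$ differ by at most $\varepsilon'$ between the two worlds, for all $\mathcal A$ with time at most $t_a$ and at most $q_u,q_t,q_v$ insertions, queries and revelations, for which the simulator needs time at most $t_s$, and all $\mathcal D$ with time at most $t_d$. *Key-storing NY filter.* Given $E$ and a standard Bloom filter $H$ (an $m$-bit array with $k$ hash functions, for every $\kappa$), draw a uniform key $sk$, store and look up $E_{sk}(x)$ instead of $x$ in $H$, and keep $sk$ as part of the representation. Its auxiliary data are $sk$. **Theorem.** Resilience under the AB test or the BP test does not imply Filić correctness, provided that PRPs exist. Precisely: let $E$ be a PRP, $n\ge 1$, $0<\varepsilon<1$ and $\varepsilon'<1$. Then there is a standard Bloom filter $H$ such that the key-storing NY filter $\mathbf B$ built from $E$ and $H$ 1. is an $(n,\varepsilon)$-insertable Bloom filter (for every $\kappa$); 2. is $(n,t,\varepsilon)$-AB resilient and $(n,t,\varepsilon)$-BP resilient for every polynomially bounded $t$; 3. is not Filić-correct: there is a polynomial $P$ such that for all sufficiently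 large $\kappa$, all $q_u,q_t\ge 0$, all $q_v\ge 1$ and all $t_a,t_s,t_d\ge P(\kappa)$, $\mathbf B$ is not $(q_u,q_t,q_v,t_a,t_s,t_d,\varepsilon')$-Filić-correct at $\kappa$. In particular, one access to the oracle that reveals the representation, which contains the key, suffices. -/

import Mathlib

/-! ## A step-counting model of probabilistic oracle computation

Values are binary trees (pointers to cons cells).  Programs are built from constant-time cell
operations, fair coins, oracle calls, branching, composition and loops along a list. -/

/-- Binary trees; lists are coded along the right spine, and a tree is read as the bit `1`
iff it is not `nil`. -/
inductive Data : Type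
  | nil : Data
  | cons : Data → Data → Data

namespace Data

def fst : Data → Data
  | nil => nil
  | cons a _ => a

def snd : Data → Data
  | nil => nil
  | cons _ b => b

def isTrue : Data → Bool
  | nil => false
  | cons _ _ => true

def ofBool : Bool → Data
  | false => nil
  | true => cons nil nil

def toList : Data → List Data
  | nil => []
  | cons a b => a :: toList b

def ofList : List Data → Data
  | [] => nil
  | a :: l => cons a (ofList l)

/-- The unary string of length `k`. -/
def unary (k : ℕ) : Data := ofList (List.replicate k nil)

/-- The code of a bit string. -/
def ofBits {k : ℕ} (v : Fin k → Bool) : Data := ofList ((List.ofFn v).map ofBool)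

/-- Every tree is read as a bit string of length `k` (missing bits are `0`). -/
def toBits (k : ℕ) (d : Data) : Fin k → Bool := fun i => (d.toList.getD i nil).isTrue

end Data

/-- The universe `{0,1}^κ` for security parameter `κ`. -/
abbrev Univ (κ : ℕ) : Type := Fin κ → Bool

/-- The code of a finite list of elements of the universe. -/
def Data.ofElems {κ : ℕ} (l : List (Univ κ)) : Data := Data.ofList (l.map Data.ofBits)

/-- The duplicate-free list of elements of the universe that a tree describes. -/
def Data.toElems (κ : ℕ) (d : Data) : List (Univ κ) := (d.toList.map (Data.toBits κ)).dedup

/-- Programs, each transforming one input tree into one output tree. -/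
inductive Prog : Type
  | nil : Prog
  | id : Prog
  | fst : Prog
  | snd : Prog
  | coin : Prog
  | call : ℕ → Prog
  | pair : Prog → Prog → Prog
  | seq : Prog → Prog → Prog
  | cond : Prog → Prog → Prog → Prog
  | fold : Prog → Prog

/-- Code length. -/
def Prog.size : Prog → ℕ
  | nil | id | fst | snd | coin => 1
  | call i => i + 1
  | pair p q => p.size + q.size + 1
  | seq p q => p.size + q.size + 1
  | cond c p q => c.size + p.size + q.size + 1
  | fold p => p.size + 1

/-- A family of randomized stateful oracles (indexed by the number in a `call`). -/
abbrev Oracle (σ : Type) : Type := ℕ → σ → Data → PMF (Data × σ)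

noncomputable section

/-- Count one step. -/
def tick {σ : Type} : StateT (ℕ × σ) PMF Unit := fun s => pure ((), (s.1 + 1, s.2))

/-- One oracle call. -/
def callOracle {σ : Type} (O : Oracle σ) (i : ℕ) (x : Data) : StateT (ℕ × σ) PMF Data :=
  fun s => do
    let r ← O i s.2 x
    pure (r.1, (s.1, r.2))

/-- A fair coin. -/
def flipCoin {σ : Type} : StateT (ℕ × σ) PMF Data :=
  fun s => do
    let b ← PMF.uniformOfFintype Bool
    pure (Data.ofBool b, s)

/-- Execution of a program on an input.  The state consists of the number of steps made so far
and the state of the oracles.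
`fold p` on `cons l s` replaces `s` by `p (cons a s)` for each entry `a` of the list `l` in turn. -/
def Prog.eval {σ : Type} (O : Oracle σ) : Prog → Data → StateT (ℕ × σ) PMF Data
  | .nil, _ => do tick; pure Data.nil
  | .id, x => do tick; pure x
  | .fst, x => do tick; pure x.fst
  | .snd, x => do tick; pure x.snd
  | .coin, _ => do tick; flipCoin
  | .call i, x => do tick; callOracle O i x
  | .pair p q, x => do
      tick
      let a ← p.eval O x
      let b ← q.eval O x
      pure (Data.cons a b)
  | .seq p q, x => do
      tick
      let a ← p.eval O x
      q.eval O a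
  | .cond c p q, x => do
      tick
      let a ← c.eval O x
      if a.isTrue then p.eval O x else q.eval O x
  | .fold p, x => do
      tick
      x.fst.toList.foldlM (fun s a => p.eval O (Data.cons a s)) x.snd

/-- Run with oracles `O` in initial state `s`: output, number of steps, final oracle state. -/
def Prog.run {σ : Type} (p : Prog) (O : Oracle σ) (s : σ) (x : Data) : PMF (Data × ℕ × σ) :=
  (p.eval O x).run (0, s)

/-- The absent oracle. -/
def noOracle : Oracle Unit := fun _ _ _ => pure (Data.nil, ())

/-- Run without oracles: output and number of steps. -/
def Prog.runPlain (p : Prog) (x : Data) : PMF (Data × ℕ) :=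
  (p.run noOracle () x).map fun r => (r.1, r.2.1)

/-- On input `x`, the program needs time at most `T` (steps, plus its own code length), whatever
the oracles do, as long as their answers lie in `Ans`. -/
def Prog.RunsWithin (p : Prog) (Ans : Set Data) (x : Data) (T : ℕ) : Prop :=
  ∀ (σ : Type) (O : Oracle σ), (∀ i s d, ∀ r ∈ (O i s d).support, r.1 ∈ Ans) →
    ∀ s : σ, ∀ r ∈ (p.run O s x).support, p.size + r.2.1 ≤ T

/-- Without oracles, on input `x`, the program makes at most `T` steps and its output has
distribution `μ`. -/
def Prog.Computes (p : Prog) (x : Data) (T : ℕ) (μ : PMF Data) : Prop :=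
  (p.runPlain x).map Prod.fst = μ ∧ ∀ r ∈ (p.runPlain x).support, r.2 ≤ T

/-- Negligible functions of the security parameter. -/
def Negligible (ν : ℕ → ℝ) : Prop :=
  Asymptotics.SuperpolynomialDecay Filter.atTop (fun κ : ℕ => (κ : ℝ)) ν

/-! ## Pseudo-random permutations -/

/-- A keyed permutation of `{0,1}^κ` with keys in `{0,1}^κ`, for every `κ`. -/
abbrev KeyedPerm : Type := ∀ κ : ℕ, Univ κ → Equiv.Perm (Univ κ)

/-- One (uniform) program evaluates the keyed permutation in polynomial time. -/
def KeyedPerm.Efficient (E : KeyedPerm) : Prop :=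
  ∃ (p : Prog) (P : Polynomial ℕ), ∀ (κ : ℕ) (sk x : Univ κ),
    p.Computes (.cons (.unary κ) (.cons (.ofBits sk) (.ofBits x))) (P.eval κ)
      (pure (.ofBits (E κ sk x)))

/-- Oracle access to a permutation. -/
def permOracle {κ : ℕ} (π : Equiv.Perm (Univ κ)) : Oracle Unit :=
  fun _ _ d => pure (Data.ofBits (π (Data.toBits κ d)), ())

/-- The output bit of a distinguisher with oracle access to `π`. -/
def distinguish {κ : ℕ} (p : Prog) (π : Equiv.Perm (Univ κ)) : PMF Bool :=
  (p.run (permOracle π) () (.unary κ)).map fun r => r.1.isTrue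

/-- `E` is a pseudo-random permutation: efficient, and no (non-uniform) probabilistic
polynomial-time oracle distinguisher tells `E κ sk`, for a uniform key `sk`, from a uniformly
random permutation with non-negligible advantage. -/
def KeyedPerm.IsPRP (E : KeyedPerm) : Prop :=
  E.Efficient ∧
  ∀ D : ℕ → Prog,
    (∃ P : Polynomial ℕ, ∀ κ, (D κ).RunsWithin
      (Set.range fun v : Univ κ => Data.ofBits v) (.unary κ) (P.eval κ)) →
    Negligible fun κ =>
      |(((PMF.uniformOfFintype (Univ κ)).bind
            fun sk => distinguish (D κ) (E κ sk)) true).toReal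
        - (((PMF.uniformOfFintype (Equiv.Perm (Univ κ))).bind
            fun π => distinguish (D κ) π) true).toReal|

/-! ## Insertable Bloom filters -/

/-- An insertable filter over the universes `{0,1}^κ`: construction, query and insertion.
A representation is an array of `len κ` bits together with auxiliary data; `idx κ` is the number
of array positions that belong to one element. -/
structure InsertableFilter where
  Aux : ℕ → Type
  encAux : ∀ κ, Aux κ → Data
  len : ℕ → ℕ
  len_pos : ∀ κ, 0 < len κ
  idx : ℕ → ℕ
  build : ∀ κ, Finset (Univ κ) → PMF (Aux κ × (Fin (len κ) → Bool))
  query : ∀ κ, Aux κ × (Fin (len κ) → Bool) → Univ κ → PMF Bool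
  insert : ∀ κ, Aux κ × (Fin (len κ) → Bool) → Univ κ → PMF (Aux κ × (Fin (len κ) → Bool))

namespace InsertableFilter

variable (B : InsertableFilter)

/-- Representations. -/
abbrev Rep (κ : ℕ) : Type := B.Aux κ × (Fin (B.len κ) → Bool)

/-- The string by which a representation is stored. -/
def encode (κ : ℕ) (M : B.Rep κ) : Data := .cons (B.encAux κ M.1) (.ofBits M.2)

/-- The three algorithms are (uniform) probabilistic polynomial-time. -/
def Efficient : Prop :=
  ∃ (b₁ b₂ b₃ : Prog) (P : Polynomial ℕ), ∀ κ : ℕ,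
    (∀ l : List (Univ κ), l.Nodup →
      b₁.Computes (.cons (.unary κ) (.ofElems l)) (P.eval (κ + l.length))
        ((B.build κ l.toFinset).map (B.encode κ))) ∧
    (∀ (M : B.Rep κ) (x : Univ κ),
      b₂.Computes (.cons (.unary κ) (.cons (B.encode κ M) (.ofBits x))) (P.eval κ)
        ((B.query κ M x).map Data.ofBool)) ∧
    (∀ (M : B.Rep κ) (x : Univ κ),
      b₃.Computes (.cons (.unary κ) (.cons (B.encode κ M) (.ofBits x))) (P.eval κ)
        ((B.insert κ M x).map (B.encode κ)))

/-- `M'` arises from `M` by a sequence of insertions. -/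
def Later (κ : ℕ) : B.Rep κ → B.Rep κ → Prop :=
  Relation.ReflTransGen fun M M' => ∃ y, M' ∈ (B.insert κ M y).support

/-- `(n, ε)`-insertable Bloom filter. -/
structure IsBloom (n : ℕ) (ε : ℝ) : Prop where
  efficient : B.Efficient
  complete : ∀ κ (S : Finset (Univ κ)), S.card = n → ∀ x ∈ S,
    ((B.build κ S).bind fun M => B.query κ M x) true = 1
  sound : ∀ κ (S : Finset (Univ κ)), S.card = n → ∀ x ∉ S,
    (((B.build κ S).bind fun M => B.query κ M x) true).toReal ≤ ε
  /-- an inserted element is represented -/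
  inserted : ∀ κ M x, ∀ M' ∈ (B.insert κ M x).support, B.query κ M' x true = 1
  permanence : ∀ κ M x, B.query κ M x true = 1 → ∀ M', B.Later κ M M' → B.query κ M' x true = 1
  monotone : ∀ κ M x, ∀ M' ∈ (B.insert κ M x).support,
    ∀ y, B.query κ M y true ≤ B.query κ M' y true

/-! ## The adaptive game, the Always-Bet test and the Bet-or-Pass test -/

/-- The query oracle `B₂(M, ·)`; its state lists the queries made. -/
def queryOracle (κ : ℕ) (M : B.Rep κ) : Oracle (List (Univ κ)) := fun _ qs d => do
  let b ← B.query κ M (Data.toBits κ d)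
  pure (Data.ofBool b, qs ++ [Data.toBits κ d])

/-- The result of the adaptive game: the set `S` (as a duplicate-free list), the representation,
the queries, and what the adversary returns in the end. -/
structure GameResult (κ : ℕ) where
  set : List (Univ κ)
  rep : B.Rep κ
  queries : List (Univ κ)
  out : Data

/-- `A₁` chooses `S`, `B₁` represents `S`, and `A₂` gets `S` and access to `B₂(M, ·)`. -/
def adaptiveGame (κ : ℕ) (A₁ A₂ : Prog) : PMF (B.GameResult κ) := do
  let a ← A₁.runPlain (.unary κ)
  let l := Data.toElems κ a.1
  let M ← B.build κ l.toFinset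
  let r ← A₂.run (B.queryOracle κ M) [] (.cons (.unary κ) (.ofElems l))
  pure ⟨l, M, r.2.2, r.1⟩

variable {B} in
/-- The adversary obeyed the rules: `|S| = n`, at most `t` queries, and the final element `x` is
neither in `S` nor among the queries. -/
def GameResult.Legal {κ : ℕ} (g : B.GameResult κ) (n t : ℕ) (x : Univ κ) : Prop :=
  g.set.length = n ∧ g.queries.length ≤ t ∧ x ∉ g.set ∧ x ∉ g.queries

open Classical in
/-- The Always-Bet test; the result is `true` iff the adversary wins. -/
def abTest (κ n t : ℕ) (A₁ A₂ : Prog) : PMF Bool := do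
  let g ← B.adaptiveGame κ A₁ A₂
  let x := Data.toBits κ g.out
  if g.Legal n t x then B.query κ g.rep x else pure false

end InsertableFilter

/-- The result of the Bet-or-Pass test: a bet on a false positive, a bet on an element that is not
a false positive, or no bet. -/
inductive BetResult : Type
  | win | lose | pass

/-- The adversary's profit. -/
def BetResult.profit (ε : ℝ) : BetResult → ℝ
  | win => 1 / ε
  | lose => -(1 / (1 - ε))
  | pass => 0

/-- The expected profit. -/
def expectedProfit (ε : ℝ) (p : PMF BetResult) : ℝ :=
  (p .win).toReal * BetResult.profit ε .win + (p .lose).toReal * BetResult.profit ε .lose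
    + (p .pass).toReal * BetResult.profit ε .pass

namespace InsertableFilter

variable (B : InsertableFilter)

open Classical in
/-- The Bet-or-Pass test.  The adversary returns a pair of a bit (bet or pass) and an element; a
run against the rules counts as a pass. -/
def bpTest (κ n t : ℕ) (A₁ A₂ : Prog) : PMF BetResult := do
  let g ← B.adaptiveGame κ A₁ A₂
  let x := Data.toBits κ g.out.snd
  if g.Legal n t x ∧ g.out.fst.isTrue = true then
    (B.query κ g.rep x).map fun b => if b then BetResult.win else BetResult.lose
  else pure BetResult.pass

/-- `(A₁, A₂)` is a (non-uniform) probabilistic polynomial-time adversary for the adaptive game: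
a sequence of programs whose code length plus number of steps is polynomially bounded. -/
def PolyAdversary (n : ℕ) (A₁ A₂ : ℕ → Prog) : Prop :=
  ∃ P : Polynomial ℕ, ∀ κ : ℕ,
    (A₁ κ).RunsWithin {Data.nil} (.unary κ) (P.eval κ) ∧
    ∀ l : List (Univ κ), l.Nodup → l.length = n →
      (A₂ κ).RunsWithin (Set.range Data.ofBool) (.cons (.unary κ) (.ofElems l)) (P.eval κ)

/-- `(n, t, ε)`-resilience under the Always-Bet test. -/
def ABResilient (n : ℕ) (t : ℕ → ℕ) (ε : ℝ) : Prop :=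
  ∀ A₁ A₂ : ℕ → Prog, PolyAdversary n A₁ A₂ → ∃ ν : ℕ → ℝ, Negligible ν ∧
    ∀ κ, (B.abTest κ n (t κ) (A₁ κ) (A₂ κ) true).toReal ≤ ε + ν κ

/-- `(n, t, ε)`-resilience under the Bet-or-Pass test. -/
def BPResilient (n : ℕ) (t : ℕ → ℕ) (ε : ℝ) : Prop :=
  ∀ A₁ A₂ : ℕ → Prog, PolyAdversary n A₁ A₂ → ∃ ν : ℕ → ℝ, Negligible ν ∧
    ∀ κ, expectedProfit ε (B.bpTest κ n (t κ) (A₁ κ) (A₂ κ)) ≤ ν κ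

end InsertableFilter

/-! ## Filić correctness -/

/-- What an adversary in the real/ideal experiment interacts with: initialization with a set,
queries, insertions, and the revealed representation. -/
structure World (κ : ℕ) where
  State : Type
  init : Finset (Univ κ) → PMF State
  query : State → Univ κ → PMF (Bool × State)
  insert : State → Univ κ → PMF State
  reveal : State → PMF (Data × State)

/-- State of a world together with the numbers of queries, insertions and revelations so far. -/
structure Counted (σ : Type) where
  st : σ
  queries : ℕ
  inserts : ℕ
  reveals : ℕ

/-- The adversary's oracles: `call 0` queries, `call 1` inserts, any other call reveals. -/
def World.oracle {κ : ℕ} (W : World κ) : Oracle (Counted W.State)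
  | 0, c, d => do
      let r ← W.query c.st (Data.toBits κ d)
      pure (Data.ofBool r.1, { c with st := r.2, queries := c.queries + 1 })
  | 1, c, d => do
      let s ← W.insert c.st (Data.toBits κ d)
      pure (Data.nil, { c with st := s, inserts := c.inserts + 1 })
  | _ + 2, c, _ => do
      let r ← W.reveal c.st
      pure (r.1, { c with st := r.2, reveals := c.reveals + 1 })

/-- The result of the experiment: the distinguisher's bit, the numbers of steps of the adversary
and of the distinguisher, and the final state. -/
structure FilicRun {κ : ℕ} (W : World κ) where
  bit : Bool
  advSteps : ℕ
  distSteps : ℕ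
  final : Counted W.State

/-- `A₁` chooses a set, `A₂` interacts with the world, and the distinguisher `D` gets the output
of `A₂`. -/
def filicExperiment {κ : ℕ} (W : World κ) (A₁ A₂ D : Prog) : PMF (FilicRun W) := do
  let a ← A₁.runPlain (.unary κ)
  let l := Data.toElems κ a.1
  let s ← W.init l.toFinset
  let r ← A₂.run W.oracle ⟨s, 0, 0, 0⟩ (.cons (.unary κ) (.ofElems l))
  let d ← D.runPlain r.1
  pure ⟨d.1.isTrue, a.2 + r.2.1, d.2, r.2.2⟩

/-- The probability that the distinguisher outputs `1`. -/
def filicProb {κ : ℕ} (W : World κ) (A₁ A₂ D : Prog) : ℝ :=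
  (((filicExperiment W A₁ A₂ D).map FilicRun.bit) true).toReal

/-- The adversary needs time at most `ta`, makes at most `qu` insertions, `qt` queries and `qv`
revelations, and the distinguisher needs time at most `td`.  Time includes code length. -/
def FilicRun.Within {κ : ℕ} {W : World κ} (r : FilicRun W) (A₁ A₂ D : Prog)
    (qu qt qv ta td : ℕ) : Prop :=
  A₁.size + A₂.size + r.advSteps ≤ ta ∧ D.size + r.distSteps ≤ td ∧
    r.final.inserts ≤ qu ∧ r.final.queries ≤ qt ∧ r.final.reveals ≤ qv

/-- The internal state of the ideal simulator. -/
structure SimState (κ m k : ℕ) (α : Type) where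
  aux : α
  f : Univ κ → Fin k → Fin m
  arr : Fin m → Bool
  inserted : List (Univ κ)
  fpList : List (Univ κ)
  ctr : ℕ
  /-- number of steps of the simulator -/
  steps : ℕ

namespace InsertableFilter

variable (B : InsertableFilter)

/-- The real world: the adversary interacts with the filter. -/
def realWorld (κ : ℕ) : World κ where
  State := B.Rep κ
  init := B.build κ
  query M x := (B.query κ M x).map fun b => (b, M)
  insert := B.insert κ
  reveal M := pure (B.encode κ M, M)

open Classical in
/-- The ideal world: the simulator of a standard Bloom filter with a truly random function `f` in
place of the hash functions, whose queries probe `idx κ` fresh random positions.  If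
representations carry auxiliary data, the simulator draws its own from `μ`.  Steps: one per array
cell when the array is set up or revealed, one per probed or set position, one per inspected list
entry, and one per operation. -/
def idealWorld (κ : ℕ) (μ : PMF (B.Aux κ)) : World κ where
  State := SimState κ (B.len κ) (B.idx κ) (B.Aux κ)
  init S :=
    haveI : NeZero (B.len κ) := ⟨(B.len_pos κ).ne'⟩
    do
      let a ← μ
      let f ← PMF.uniformOfFintype (Univ κ → Fin (B.idx κ) → Fin (B.len κ))
      pure
        { aux := a
          f := f
          arr := fun j => decide (∃ x ∈ S, ∃ i, f x i = j)
          inserted := S.toList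
          fpList := []
          ctr := S.card
          steps := B.len κ + S.card * (B.idx κ + 1) }
  query s x :=
    haveI : NeZero (B.len κ) := ⟨(B.len_pos κ).ne'⟩
    let s' := { s with
      steps := s.steps + s.inserted.length + s.fpList.length + B.idx κ + 1 }
    if x ∈ s.inserted ∨ x ∈ s.fpList then pure (true, s')
    else do
      let v ← PMF.uniformOfFintype (Fin (B.idx κ) → Fin (B.len κ))
      if ∀ i, s.arr (v i) = true then pure (true, { s' with fpList := x :: s.fpList })
      else pure (false, s')
  insert s x :=
    let s' := { s with steps := s.steps + s.inserted.length + B.idx κ + 1 }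
    if x ∈ s.inserted then pure s'
    else pure { s' with
      arr := fun j => s.arr j || decide (∃ i, s.f x i = j)
      inserted := x :: s.inserted
      ctr := s.ctr + 1 }
  reveal s := pure (B.encode κ (s.aux, s.arr), { s with steps := s.steps + B.len κ + 1 })

/-- `(qu, qt, qv, ta, ts, td, ε)`-Filić correctness at security parameter `κ`: for all adversaries
and distinguishers within the given bounds, for which the ideal simulator needs time at most `ts`,
the real and the ideal world differ by at most `ε`. -/
def FilicCorrect (κ qu qt qv ta ts td : ℕ) (ε : ℝ) : Prop :=
  ∃ μ : PMF (B.Aux κ), ∀ A₁ A₂ D : Prog,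
    (∀ r ∈ (filicExperiment (B.realWorld κ) A₁ A₂ D).support,
      r.Within A₁ A₂ D qu qt qv ta td) →
    (∀ r ∈ (filicExperiment (B.idealWorld κ μ) A₁ A₂ D).support,
      r.Within A₁ A₂ D qu qt qv ta td ∧ SimState.steps r.final.st ≤ ts) →
    |filicProb (B.realWorld κ) A₁ A₂ D - filicProb (B.idealWorld κ μ) A₁ A₂ D| ≤ ε

end InsertableFilter

/-! ## Standard Bloom filters and the key-storing Naor–Yogev filter -/

/-- The parameters of a standard Bloom filter over `{0,1}^κ`, for every `κ`: array length, number
of hash functions, and the hash functions. -/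
structure StandardBloom where
  m : ℕ → ℕ
  m_pos : ∀ κ, 0 < m κ
  k : ℕ → ℕ
  hash : ∀ κ, Fin (k κ) → Univ κ → Fin (m κ)

namespace StandardBloom

variable (H : StandardBloom)

/-- The array of a set: the bits at the hash values of its elements. -/
def array (κ : ℕ) (S : Finset (Univ κ)) : Fin (H.m κ) → Bool :=
  fun j => decide (∃ x ∈ S, ∃ i, H.hash κ i x = j)

/-- Are all bits at the hash values of `x` set? -/
def lookup (κ : ℕ) (M : Fin (H.m κ) → Bool) (x : Univ κ) : Bool :=
  decide (∀ i, M (H.hash κ i x) = true)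

/-- Set the bits at the hash values of `x`. -/
def add (κ : ℕ) (M : Fin (H.m κ) → Bool) (x : Univ κ) : Fin (H.m κ) → Bool :=
  fun j => M j || decide (∃ i, H.hash κ i x = j)

end StandardBloom

/-- The Naor–Yogev filter that keeps its key in its representation: draw a uniform key `sk`, and
store and look up `E κ sk x` in place of `x` in a standard Bloom filter. -/
def keyStoringNY (E : KeyedPerm) (H : StandardBloom) : InsertableFilter where
  Aux := Univ
  encAux _ sk := Data.ofBits sk
  len := H.m
  len_pos := H.m_pos
  idx := H.k
  build κ S := do
    let sk ← PMF.uniformOfFintype (Univ κ)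
    pure (sk, H.array κ (S.image (E κ sk)))
  query κ M x := pure (H.lookup κ M.2 (E κ M.1 x))
  insert κ M x := pure (M.1, H.add κ M.2 (E κ M.1 x))

end

noncomputable section

namespace Prog

variable {σ : Type}

/-- Iteration of a state-dependent step along a list. -/
def loop (f : Data → σ → PMF (Data × σ)) : List Data → Data → σ → PMF (Data × σ)
  | [], d, s => PMF.pure (d, s)
  | a :: l, d, s => (f (.cons a d) s).bind fun r => loop f l r.1 r.2

/-- Execution without the step counter. -/
def sem (O : Oracle σ) : Prog → Data → σ → PMF (Data × σ)
  | .nil, _, s => PMF.pure (.nil, s)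
  | .id, x, s => PMF.pure (x, s)
  | .fst, x, s => PMF.pure (x.fst, s)
  | .snd, x, s => PMF.pure (x.snd, s)
  | .coin, _, s => (PMF.uniformOfFintype Bool).bind fun b => PMF.pure (Data.ofBool b, s)
  | .call i, x, s => O i s x
  | .pair p q, x, s => (p.sem O x s).bind fun r =>
      (q.sem O x r.2).bind fun r' => PMF.pure (.cons r.1 r'.1, r'.2)
  | .seq p q, x, s => (p.sem O x s).bind fun r => q.sem O r.1 r.2
  | .cond c p q, x, s => (c.sem O x s).bind fun r =>
      if r.1.isTrue then p.sem O x r.2 else q.sem O x r.2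
  | .fold p, x, s => loop (p.sem O) x.fst.toList x.snd s

section eval

variable (O : Oracle σ) (x : Data) (n : ℕ) (s : σ)

theorem eval_nil : Prog.nil.eval O x (n, s) = PMF.pure (.nil, n + 1, s) :=
  PMF.pure_bind _ _

theorem eval_id : Prog.id.eval O x (n, s) = PMF.pure (x, n + 1, s) :=
  PMF.pure_bind _ _

theorem eval_fst : Prog.fst.eval O x (n, s) = PMF.pure (x.fst, n + 1, s) :=
  PMF.pure_bind _ _

theorem eval_snd : Prog.snd.eval O x (n, s) = PMF.pure (x.snd, n + 1, s) :=
  PMF.pure_bind _ _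

theorem eval_coin : Prog.coin.eval O x (n, s) =
    (PMF.uniformOfFintype Bool).bind fun b => PMF.pure (Data.ofBool b, n + 1, s) :=
  PMF.pure_bind _ _

theorem eval_call (i : ℕ) : (Prog.call i).eval O x (n, s) =
    (O i s x).bind fun r => PMF.pure (r.1, n + 1, r.2) :=
  PMF.pure_bind _ _

theorem eval_pair (p q : Prog) : (Prog.pair p q).eval O x (n, s) =
    (p.eval O x (n + 1, s)).bind fun r =>
      (q.eval O x r.2).bind fun r' => PMF.pure (.cons r.1 r'.1, r'.2) :=
  PMF.pure_bind _ _

theorem eval_seq (p q : Prog) : (Prog.seq p q).eval O x (n, s) =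
    (p.eval O x (n + 1, s)).bind fun r => q.eval O r.1 r.2 :=
  PMF.pure_bind _ _

theorem eval_cond (c p q : Prog) : (Prog.cond c p q).eval O x (n, s) =
    (c.eval O x (n + 1, s)).bind fun r =>
      if r.1.isTrue then p.eval O x r.2 else q.eval O x r.2 := by
  refine (PMF.pure_bind _ _).trans ?_
  refine congrArg (PMF.bind _) (funext fun r => ?_)
  show (if r.1.isTrue = true then p.eval O x else q.eval O x) r.2 = _
  split <;> rfl

theorem foldlM_eq_loop (f : Data → StateT (ℕ × σ) PMF Data) (l : List Data) :
    ∀ (d : Data) (s : ℕ × σ),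
      l.foldlM (fun s a => f (Data.cons a s)) d s = loop f l d s := by
  induction l with
  | nil => intro d s; rfl
  | cons a l ih =>
    intro d s
    rw [List.foldlM_cons]
    exact congrArg (PMF.bind _) (funext fun r => ih r.1 r.2)

theorem eval_fold (p : Prog) : (Prog.fold p).eval O x (n, s) =
    loop (p.eval O) x.fst.toList x.snd (n + 1, s) :=
  (PMF.pure_bind _ _).trans (foldlM_eq_loop _ _ _ _)

end eval

/-- The counter has no influence on outputs and oracle states. -/
theorem map_eval (O : Oracle σ) (p : Prog) : ∀ (x : Data) (n : ℕ) (s : σ),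
    (p.eval O x (n, s)).map (fun r => (r.1, r.2.2)) = p.sem O x s := by
  induction p with
  | nil => intro x n s; rw [eval_nil, PMF.pure_map]; rfl
  | id => intro x n s; rw [eval_id, PMF.pure_map]; rfl
  | fst => intro x n s; rw [eval_fst, PMF.pure_map]; rfl
  | snd => intro x n s; rw [eval_snd, PMF.pure_map]; rfl
  | coin => intro x n s; rw [eval_coin, PMF.map_bind]; simp only [PMF.pure_map]; rfl
  | call i =>
    intro x n s
    rw [eval_call, PMF.map_bind]
    simp only [PMF.pure_map]
    exact PMF.bind_pure _
  | pair p q ihp ihq =>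
    intro x n s
    rw [eval_pair, sem, ← ihp x (n + 1) s, PMF.bind_map, PMF.map_bind]
    refine congrArg (PMF.bind _) (funext fun r => ?_)
    rw [Function.comp, ← ihq x r.2.1 r.2.2, PMF.bind_map, PMF.map_bind]
    simp only [PMF.pure_map]
    rfl
  | seq p q ihp ihq =>
    intro x n s
    rw [eval_seq, sem, ← ihp x (n + 1) s, PMF.bind_map, PMF.map_bind]
    exact congrArg (PMF.bind _) (funext fun r => ihq r.1 r.2.1 r.2.2)
  | cond c p q ihc ihp ihq =>
    intro x n s
    rw [eval_cond, sem, ← ihc x (n + 1) s, PMF.bind_map, PMF.map_bind]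
    refine congrArg (PMF.bind _) (funext fun r => ?_)
    simp only [Function.comp]
    split
    · exact ihp x r.2.1 r.2.2
    · exact ihq x r.2.1 r.2.2
  | fold p ih =>
    intro x n s
    rw [eval_fold, sem]
    generalize x.fst.toList = l
    generalize x.snd = d
    generalize n + 1 = n
    induction l generalizing d n s with
    | nil => rw [loop, PMF.pure_map]; rfl
    | cons a l ihl =>
      rw [loop, loop, ← ih _ n s, PMF.bind_map, PMF.map_bind]
      exact congrArg (PMF.bind _) (funext fun r => ihl r.2.2 r.1 r.2.1)

/-- Every outcome of a run is an outcome of a run from any other value of the counter, with the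
same number of steps. -/
theorem mem_support_eval_shift (O : Oracle σ) (p : Prog) : ∀ (x : Data) (n : ℕ) (s : σ),
    ∀ r ∈ (p.eval O x (n, s)).support,
      ∃ k, r.2.1 = n + k ∧ ∀ m, (r.1, m + k, r.2.2) ∈ (p.eval O x (m, s)).support := by
  induction p with
  | nil => intro x n s r hr; refine ⟨1, ?_⟩; simp_all [eval_nil]
  | id => intro x n s r hr; refine ⟨1, ?_⟩; simp_all [eval_id]
  | fst => intro x n s r hr; refine ⟨1, ?_⟩; simp_all [eval_fst]
  | snd => intro x n s r hr; refine ⟨1, ?_⟩; simp_all [eval_snd]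
  | coin =>
    intro x n s r hr
    rw [eval_coin, PMF.mem_support_bind_iff] at hr
    obtain ⟨b, hb, hr⟩ := hr
    rw [PMF.mem_support_pure_iff] at hr
    subst hr
    refine ⟨1, rfl, fun m => ?_⟩
    rw [eval_coin, PMF.mem_support_bind_iff]
    exact ⟨b, hb, (PMF.mem_support_pure_iff _ _).2 rfl⟩
  | call i =>
    intro x n s r hr
    rw [eval_call, PMF.mem_support_bind_iff] at hr
    obtain ⟨b, hb, hr⟩ := hr
    rw [PMF.mem_support_pure_iff] at hr
    subst hr
    refine ⟨1, rfl, fun m => ?_⟩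
    rw [eval_call, PMF.mem_support_bind_iff]
    exact ⟨b, hb, (PMF.mem_support_pure_iff _ _).2 rfl⟩
  | pair p q ihp ihq =>
    intro x n s r hr
    rw [eval_pair, PMF.mem_support_bind_iff] at hr
    obtain ⟨⟨a, n₁, s₁⟩, ha, hr⟩ := hr
    rw [PMF.mem_support_bind_iff] at hr
    obtain ⟨⟨b, n₂, s₂⟩, hb, hr⟩ := hr
    rw [PMF.mem_support_pure_iff] at hr
    subst hr
    obtain ⟨k₁, h₁, ha⟩ := ihp _ _ _ _ ha
    obtain ⟨k₂, h₂, hb⟩ := ihq _ _ _ _ hb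
    refine ⟨1 + k₁ + k₂, by simp only at h₁ h₂ ⊢; omega, fun m => ?_⟩
    rw [eval_pair, PMF.mem_support_bind_iff]
    refine ⟨_, ha (m + 1), ?_⟩
    rw [PMF.mem_support_bind_iff]
    refine ⟨_, hb _, ?_⟩
    rw [PMF.mem_support_pure_iff]
    simp only [add_assoc]
  | seq p q ihp ihq =>
    intro x n s r hr
    rw [eval_seq, PMF.mem_support_bind_iff] at hr
    obtain ⟨⟨a, n₁, s₁⟩, ha, hr⟩ := hr
    obtain ⟨k₁, h₁, ha⟩ := ihp _ _ _ _ ha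
    obtain ⟨k₂, h₂, hb⟩ := ihq _ _ _ _ hr
    refine ⟨1 + k₁ + k₂, by simp only at h₁ h₂ ⊢; omega, fun m => ?_⟩
    rw [eval_seq, PMF.mem_support_bind_iff]
    refine ⟨_, ha (m + 1), ?_⟩
    simpa only [add_assoc] using hb (m + 1 + k₁)
  | cond c p q ihc ihp ihq =>
    intro x n s r hr
    rw [eval_cond, PMF.mem_support_bind_iff] at hr
    obtain ⟨⟨a, n₁, s₁⟩, ha, hr⟩ := hr
    obtain ⟨k₁, h₁, ha⟩ := ihc _ _ _ _ ha
    have : ∃ k, r.2.1 = n₁ + k ∧ ∀ m, (r.1, m + k, r.2.2) ∈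
        (if a.isTrue then p.eval O x (m, s₁) else q.eval O x (m, s₁)).support := by
      by_cases h : a.isTrue
      · simp only [h, if_true] at hr ⊢
        exact ihp _ _ _ _ hr
      · simp only [h] at hr ⊢
        exact ihq _ _ _ _ hr
    obtain ⟨k₂, h₂, hb⟩ := this
    refine ⟨1 + k₁ + k₂, by simp only at h₁ h₂ ⊢; omega, fun m => ?_⟩
    rw [eval_cond, PMF.mem_support_bind_iff]
    refine ⟨_, ha (m + 1), ?_⟩
    simpa only [add_assoc] using hb (m + 1 + k₁)
  | fold p ih =>
    intro x n s r hr
    simp only [eval_fold] at hr ⊢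
    generalize x.fst.toList = l at *
    generalize x.snd = d at *
    suffices H : ∀ n, r ∈ (loop (p.eval O) l d (n, s)).support → ∃ k, r.2.1 = n + k ∧
        ∀ m, (r.1, m + k, r.2.2) ∈ (loop (p.eval O) l d (m, s)).support by
      obtain ⟨k, h, hk⟩ := H _ hr
      refine ⟨1 + k, by omega, fun m => ?_⟩
      simpa only [add_assoc] using hk (m + 1)
    clear hr
    induction l generalizing d s with
    | nil =>
      intro n hr
      rw [loop, PMF.mem_support_pure_iff] at hr
      subst hr
      refine ⟨0, rfl, fun m => ?_⟩
      rw [loop, PMF.mem_support_pure_iff]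
      rfl
    | cons a l ihl =>
      intro n hr
      rw [loop, PMF.mem_support_bind_iff] at hr
      obtain ⟨⟨a, n₁, s₁⟩, ha, hr⟩ := hr
      obtain ⟨k₁, h₁, ha⟩ := ih _ _ _ _ ha
      obtain ⟨k₂, h₂, hb⟩ := ihl _ _ _ hr
      refine ⟨k₁ + k₂, by simp only at h₁ h₂ ⊢; omega, fun m => ?_⟩
      rw [loop, PMF.mem_support_bind_iff]
      refine ⟨_, ha m, ?_⟩
      simpa only [add_assoc] using hb (m + k₁)

/-- Straight-line programs: no coins, oracle calls or loops. -/
def Plain : Prog → Prop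
  | .nil | .id | .fst | .snd => True
  | .coin | .call _ | .fold _ => False
  | .pair p q => p.Plain ∧ q.Plain
  | .seq p q => p.Plain ∧ q.Plain
  | .cond c p q => c.Plain ∧ p.Plain ∧ q.Plain

/-- The function computed by a straight-line program. -/
def fn : Prog → Data → Data
  | .id, x => x
  | .fst, x => x.fst
  | .snd, x => x.snd
  | .pair p q, x => .cons (p.fn x) (q.fn x)
  | .seq p q, x => q.fn (p.fn x)
  | .cond c p q, x => if (c.fn x).isTrue then p.fn x else q.fn x
  | _, _ => .nil

/-- Programs without loops. -/
def LoopFree : Prog → Prop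
  | .nil | .id | .fst | .snd | .coin | .call _ => True
  | .fold _ => False
  | .pair p q => p.LoopFree ∧ q.LoopFree
  | .seq p q => p.LoopFree ∧ q.LoopFree
  | .cond c p q => c.LoopFree ∧ p.LoopFree ∧ q.LoopFree

theorem Plain.loopFree {p : Prog} (hp : p.Plain) : p.LoopFree := by
  induction p <;> simp_all [Plain, LoopFree]

/-- A program without loops makes at most as many steps as its code is long. -/
theorem LoopFree.steps_le (O : Oracle σ) {p : Prog} (hp : p.LoopFree) :
    ∀ (x : Data) (n : ℕ) (s : σ), ∀ r ∈ (p.eval O x (n, s)).support, r.2.1 ≤ n + p.size := by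
  induction p with
  | nil => intro x n s r hr; simp_all [eval_nil, size]
  | id => intro x n s r hr; simp_all [eval_id, size]
  | fst => intro x n s r hr; simp_all [eval_fst, size]
  | snd => intro x n s r hr; simp_all [eval_snd, size]
  | coin =>
    intro x n s r hr
    rw [eval_coin, PMF.mem_support_bind_iff] at hr
    obtain ⟨b, hb, hr⟩ := hr
    rw [PMF.mem_support_pure_iff] at hr
    subst hr
    simp [size]
  | call i =>
    intro x n s r hr
    rw [eval_call, PMF.mem_support_bind_iff] at hr
    obtain ⟨b, hb, hr⟩ := hr
    rw [PMF.mem_support_pure_iff] at hr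
    subst hr
    simp [size]
  | pair p q ihp ihq =>
    intro x n s r hr
    rw [eval_pair, PMF.mem_support_bind_iff] at hr
    obtain ⟨⟨a, n₁, s₁⟩, ha, hr⟩ := hr
    rw [PMF.mem_support_bind_iff] at hr
    obtain ⟨⟨b, n₂, s₂⟩, hb, hr⟩ := hr
    rw [PMF.mem_support_pure_iff] at hr
    subst hr
    have h₁ := ihp hp.1 _ _ _ _ ha
    have h₂ := ihq hp.2 _ _ _ _ hb
    simp only [size] at h₁ h₂ ⊢
    omega
  | seq p q ihp ihq =>
    intro x n s r hr
    rw [eval_seq, PMF.mem_support_bind_iff] at hr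
    obtain ⟨⟨a, n₁, s₁⟩, ha, hr⟩ := hr
    have h₁ := ihp hp.1 _ _ _ _ ha
    have h₂ := ihq hp.2 _ _ _ _ hr
    simp only [size] at h₁ h₂ ⊢
    omega
  | cond c p q ihc ihp ihq =>
    intro x n s r hr
    rw [eval_cond, PMF.mem_support_bind_iff] at hr
    obtain ⟨⟨a, n₁, s₁⟩, ha, hr⟩ := hr
    have h₁ := ihc hp.1 _ _ _ _ ha
    by_cases h : a.isTrue
    · simp only [h, if_true] at hr
      have h₂ := ihp hp.2.1 _ _ _ _ hr
      simp only [size] at h₁ h₂ ⊢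
      omega
    · simp only [h] at hr
      have h₂ := ihq hp.2.2 _ _ _ _ hr
      simp only [size] at h₁ h₂ ⊢
      omega
  | fold p ih => exact hp.elim

theorem Plain.sem_eq (O : Oracle σ) {p : Prog} (hp : p.Plain) :
    ∀ (x : Data) (s : σ), p.sem O x s = PMF.pure (p.fn x, s) := by
  induction p with
  | nil | id | fst | snd => intro x s; rfl
  | coin | call _ | fold _ => exact hp.elim
  | pair p q ihp ihq =>
    intro x s
    rw [sem, ihp hp.1, PMF.pure_bind, ihq hp.2, PMF.pure_bind]
    rfl
  | seq p q ihp ihq =>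
    intro x s
    rw [sem, ihp hp.1, PMF.pure_bind, ihq hp.2]
    rfl
  | cond c p q ihc ihp ihq =>
    intro x s
    rw [sem, ihc hp.1, PMF.pure_bind, ihp hp.2.1, ihq hp.2.2, fn]
    split <;> rfl

end Prog

end

noncomputable section

namespace Data

@[simp] theorem fst_cons (a b : Data) : (cons a b).fst = a := rfl

@[simp] theorem snd_cons (a b : Data) : (cons a b).snd = b := rfl

@[simp] theorem isTrue_cons (a b : Data) : (cons a b).isTrue = true := rfl

@[simp] theorem isTrue_nil : nil.isTrue = false := rfl

@[simp] theorem isTrue_ofBool (b : Bool) : (ofBool b).isTrue = b := by cases b <;> rfl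

theorem toList_ofList (l : List Data) : (ofList l).toList = l := by
  induction l with
  | nil => rfl
  | cons a l ih => rw [ofList, toList, ih]

/-- The `i`-th bit of a tree that is read as a bit string. -/
def bit (i : ℕ) (d : Data) : Bool := (d.toList.getD i nil).isTrue

theorem bit_zero (d : Data) : bit 0 d = d.fst.isTrue := by cases d <;> rfl

theorem bit_succ (i : ℕ) (d : Data) : bit (i + 1) d = bit i d.snd := by
  cases d with
  | nil => simp [bit, toList, snd]
  | cons a b => rfl

theorem bit_ofBits {k : ℕ} (v : Fin k → Bool) (i : ℕ) :
    bit i (ofBits v) = if h : i < k then v ⟨i, h⟩ else false := by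
  rw [bit, ofBits, toList_ofList, List.getD_eq_getElem?_getD]
  by_cases h : i < k
  · simp [h]
  · simp [h, isTrue]

@[simp] theorem toBits_ofBits {k : ℕ} (v : Fin k → Bool) : toBits k (ofBits v) = v := by
  funext i
  exact (bit_ofBits v i).trans (by simp)

/-- The number with binary digits the first `c` bits of a string. -/
def idx : ℕ → Data → ℕ
  | 0, _ => 0
  | c + 1, d => 2 * idx c d.snd + d.fst.isTrue.toNat

theorem idx_lt (c : ℕ) : ∀ d, idx c d < 2 ^ c := by
  induction c with
  | zero => intro d; simp [idx]
  | succ c ih =>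
    intro d
    have := ih d.snd
    have h : d.fst.isTrue.toNat ≤ 1 := Bool.toNat_le _
    rw [idx, pow_succ]
    omega

theorem idx_succ_eq_iff (c : ℕ) (a b : Data) : idx (c + 1) a = idx (c + 1) b ↔
    a.fst.isTrue = b.fst.isTrue ∧ idx c a.snd = idx c b.snd := by
  rw [idx, idx]
  cases a.fst.isTrue <;> cases b.fst.isTrue <;> simp <;> omega

theorem idx_eq_iff (c : ℕ) : ∀ a b : Data, idx c a = idx c b ↔ ∀ i < c, bit i a = bit i b := by
  induction c with
  | zero => intro a b; simp [idx]
  | succ c ih =>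
    intro a b
    rw [idx_succ_eq_iff, ih]
    constructor
    · rintro ⟨h₀, h⟩ (_ | i) hi
      · rw [bit_zero, bit_zero, h₀]
      · rw [bit_succ, bit_succ, h i (by omega)]
    · intro h
      refine ⟨by simpa only [bit_zero] using h 0 (by omega), fun i hi => ?_⟩
      simpa only [bit_succ] using h (i + 1) (by omega)

theorem idx_ofBits_eq_iff (c : ℕ) {k : ℕ} (v w : Fin k → Bool) :
    idx c (ofBits v) = idx c (ofBits w) ↔ ∀ i : Fin k, (i : ℕ) < c → v i = w i := by
  rw [idx_eq_iff]
  simp only [bit_ofBits]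
  constructor
  · intro h i hi
    simpa using h i hi
  · intro h i hi
    split
    · exact h _ hi
    · rfl

theorem idx_ofBits_inj {c k : ℕ} (h : k ≤ c) {v w : Fin k → Bool} :
    idx c (ofBits v) = idx c (ofBits w) ↔ v = w := by
  rw [idx_ofBits_eq_iff]
  exact ⟨fun H => funext fun i => H i (i.2.trans_le h), fun H i _ => H ▸ rfl⟩

theorem card_idx_fiber_le {c k : ℕ} (h : c ≤ k) (j : ℕ) :
    (Finset.univ.filter fun v : Fin k → Bool => idx c (ofBits v) = j).card ≤ 2 ^ (k - c) := by
  have : (2 : ℕ) ^ (k - c) = (Finset.univ : Finset (Fin (k - c) → Bool)).card := by simp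
  rw [this]
  refine Finset.card_le_card_of_injOn (fun v i => v ⟨c + i, by omega⟩) (fun _ _ => by simp) ?_
  intro v hv w hw hvw
  simp only [Finset.coe_filter, Finset.mem_univ, true_and, Set.mem_ofPred_eq] at hv hw
  have hlt := (idx_ofBits_eq_iff c v w).1 (hv.trans hw.symm)
  funext i
  by_cases hi : (i : ℕ) < c
  · exact hlt i hi
  · have := congrFun hvw ⟨i - c, by omega⟩
    simpa [show c + ((i : ℕ) - c) = i by omega] using this

end Data

namespace Prog

/-- The program with a constant output. -/
def const : Data → Prog
  | .nil => .nil
  | .cons a b => .pair (const a) (const b)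

theorem const_plain (d : Data) : (const d).Plain := by
  induction d with
  | nil => trivial
  | cons a b iha ihb => exact ⟨iha, ihb⟩

@[simp] theorem const_fn (d x : Data) : (const d).fn x = d := by
  induction d with
  | nil => rfl
  | cons a b iha ihb => rw [const, fn, iha, ihb]

theorem const_ofBool_size (b : Bool) : (const (Data.ofBool b)).size ≤ 3 := by
  cases b <;> simp [Data.ofBool, const, size]

theorem const_ofList_size {α : Type} (f : α → Data) (s : ℕ) (hs : ∀ a, (const (f a)).size ≤ s)
    (l : List α) : (const (Data.ofList (l.map f))).size ≤ (s + 1) * l.length + 1 := by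
  induction l with
  | nil => simp [Data.ofList, const, size]
  | cons a l ih =>
    have := hs a
    simp only [List.map_cons, Data.ofList, const, size, List.length_cons] at ih ⊢
    linarith

theorem const_ofBits_size {k : ℕ} (v : Fin k → Bool) :
    (const (Data.ofBits v)).size ≤ 4 * k + 1 := by
  simpa [Data.ofBits] using const_ofList_size Data.ofBool 3 const_ofBool_size (List.ofFn v)

theorem const_ofElems_size {κ : ℕ} (l : List (Univ κ)) :
    (const (Data.ofElems l)).size ≤ (4 * κ + 2) * l.length + 1 :=
  const_ofList_size Data.ofBits (4 * κ + 1) const_ofBits_size l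

/-- The constant bit `1`. -/
def tt : Prog := .pair .nil .nil

/-- Do the first bits of two strings agree? -/
def bitEqP : Prog :=
  .cond (.seq .fst .fst) (.cond (.seq .snd .fst) tt .nil) (.cond (.seq .snd .fst) .nil tt)

/-- Do the first `j` bits of two strings agree? -/
def eqP : ℕ → Prog
  | 0 => tt
  | j + 1 => .cond bitEqP (.seq (.pair (.seq .fst .snd) (.seq .snd .snd)) (eqP j)) .nil

theorem eqP_plain (j : ℕ) : (eqP j).Plain := by
  induction j with
  | zero => simp [eqP, tt, Plain]
  | succ j ih => simp [eqP, tt, bitEqP, Plain, ih]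

theorem eqP_size (j : ℕ) : (eqP j).size = 30 * j + 3 := by
  induction j with
  | zero => rfl
  | succ j ih => simp only [eqP, bitEqP, tt, size, ih]; omega

theorem eqP_fn (j : ℕ) : ∀ a b : Data,
    (eqP j).fn (.cons a b) = Data.ofBool (decide (a.idx j = b.idx j)) := by
  induction j with
  | zero => intro a b; simp [eqP, tt, fn, Data.idx, Data.ofBool]
  | succ j ih =>
    intro a b
    simp only [eqP, fn, bitEqP, tt, Data.fst_cons, Data.snd_cons, ih, Data.idx_succ_eq_iff]
    generalize a.snd.idx j = u, b.snd.idx j = v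
    by_cases ha : a.fst.isTrue = true <;> by_cases hb : b.fst.isTrue = true <;>
      simp [ha, hb, Data.ofBool]

/-- Do the first `j` bits of a string agree with those of one of the first `k` entries of a
list? -/
def memP : ℕ → ℕ → Prog
  | 0, _ => .nil
  | k + 1, j => .cond .fst
      (.cond (.seq (.pair (.seq .fst .fst) .snd) (eqP j)) tt
        (.seq (.pair (.seq .fst .snd) .snd) (memP k j))) .nil

theorem memP_plain (k j : ℕ) : (memP k j).Plain := by
  induction k with
  | zero => trivial
  | succ k ih => simp [memP, tt, Plain, ih, eqP_plain]

theorem memP_size (k j : ℕ) : (memP k j).size = (30 * j + 22) * k + 1 := by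
  induction k with
  | zero => simp [memP, size]
  | succ k ih => simp only [memP, tt, size, ih, eqP_size]; ring

theorem memP_fn (j : ℕ) {κ : ℕ} (l : List (Univ κ)) (y : Data) : ∀ k, l.length ≤ k →
    (memP k j).fn (.cons (.ofElems l) y) =
      Data.ofBool (l.any fun a => decide ((Data.ofBits a).idx j = y.idx j)) := by
  induction l with
  | nil => intro k _; cases k <;> rfl
  | cons a l ih =>
    rintro (_ | k) hk
    · simp at hk
    · have ih' := ih k (by simpa using hk)
      simp only [Data.ofElems] at ih'
      simp only [memP, fn, tt, Data.ofElems, List.map_cons, Data.ofList, Data.fst_cons, Data.snd_cons,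
        eqP_fn, ih', Data.isTrue_ofBool, List.any_cons]
      simp only [Data.isTrue_cons, if_true]
      by_cases h : (Data.ofBits a).idx j = y.idx j <;> simp [h, Data.ofBool]

/-- Remove the first `k` entries of a list. -/
def dropP : ℕ → Prog
  | 0 => .id
  | k + 1 => .seq .snd (dropP k)

theorem dropP_plain (k : ℕ) : (dropP k).Plain := by
  induction k with
  | zero => trivial
  | succ k ih => exact ⟨trivial, ih⟩

theorem dropP_size (k : ℕ) : (dropP k).size = 2 * k + 1 := by
  induction k with
  | zero => rfl
  | succ k ih => simp only [dropP, size, ih]; omega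

theorem dropP_nil (k : ℕ) : (dropP k).fn .nil = .nil := by
  induction k with
  | zero => rfl
  | succ k ih => exact ih

theorem dropP_isTrue (l : List Data) : ∀ k,
    ((dropP k).fn (.ofList l)).isTrue = decide (k < l.length) := by
  induction l with
  | nil => intro k; simp [Data.ofList, dropP_nil, Data.isTrue]
  | cons a l ih =>
    rintro (_ | k)
    · simp [Data.ofList, dropP, fn, Data.isTrue]
    · simp [Data.ofList, dropP, fn, Data.snd, ih]

/-- The exchange `(u, (v, w)) ↦ (v, (u, w))`. -/
def exch : Prog := .pair (.seq .snd .fst) (.pair .fst (.seq .snd .snd))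

/-- Simulation of a program: a state is threaded through, and the handler `C` answers the oracle
calls, transforming a pair of a state and a question into one of a state and an answer. -/
def sim (C : Prog) : Prog → Prog
  | .nil => .pair .fst .nil
  | .id => .id
  | .fst => .pair .fst (.seq .snd .fst)
  | .snd => .pair .fst (.seq .snd .snd)
  | .coin => .pair .fst .coin
  | .call _ => C
  | .pair p q => .seq (.pair (sim C p) .snd)
      (.seq (.pair (.seq .fst .snd) (.seq (.pair (.seq .fst .fst) .snd) (sim C q))) exch)
  | .seq p q => .seq (sim C p) (sim C q)
  | .cond c p q => .seq (.pair (sim C c) .snd)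
      (.cond (.seq .fst .snd) (.seq (.pair (.seq .fst .fst) .snd) (sim C p))
        (.seq (.pair (.seq .fst .fst) .snd) (sim C q)))
  | .fold p => .seq exch (.fold (.seq exch (sim C p)))

theorem sim_size (C p : Prog) : (sim C p).size ≤ (C.size + 30) * p.size := by
  induction p with
  | nil | id | fst | snd | coin => simp only [sim, size]; omega
  | call i => simp only [sim, size]; nlinarith [Nat.zero_le (C.size * i)]
  | pair p q ihp ihq => simp only [sim, exch, size]; nlinarith
  | seq p q ihp ihq => simp only [sim, size]; nlinarith
  | cond c p q ihc ihp ihq => simp only [sim, size]; nlinarith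
  | fold p ih => simp only [sim, exch, size]; nlinarith

section eval

variable {σ : Type} (O : Oracle σ) (x : Data) (s : ℕ × σ)

theorem eval_nil' : Prog.nil.eval O x s = PMF.pure (.nil, s.1 + 1, s.2) := eval_nil O x s.1 s.2

theorem eval_id' : Prog.id.eval O x s = PMF.pure (x, s.1 + 1, s.2) := eval_id O x s.1 s.2

theorem eval_fst' : Prog.fst.eval O x s = PMF.pure (x.fst, s.1 + 1, s.2) := eval_fst O x s.1 s.2

theorem eval_snd' : Prog.snd.eval O x s = PMF.pure (x.snd, s.1 + 1, s.2) := eval_snd O x s.1 s.2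

theorem eval_coin' : Prog.coin.eval O x s =
    (PMF.uniformOfFintype Bool).bind fun b => PMF.pure (Data.ofBool b, s.1 + 1, s.2) :=
  eval_coin O x s.1 s.2

theorem eval_call' (i : ℕ) : (Prog.call i).eval O x s =
    (O i s.2 x).bind fun r => PMF.pure (r.1, s.1 + 1, r.2) :=
  eval_call O x s.1 s.2 i

theorem eval_pair' (p q : Prog) : (Prog.pair p q).eval O x s =
    (p.eval O x (s.1 + 1, s.2)).bind fun r =>
      (q.eval O x r.2).bind fun r' => PMF.pure (.cons r.1 r'.1, r'.2) :=
  eval_pair O x s.1 s.2 p q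

theorem eval_seq' (p q : Prog) : (Prog.seq p q).eval O x s =
    (p.eval O x (s.1 + 1, s.2)).bind fun r => q.eval O r.1 r.2 :=
  eval_seq O x s.1 s.2 p q

theorem eval_cond' (c p q : Prog) : (Prog.cond c p q).eval O x s =
    (c.eval O x (s.1 + 1, s.2)).bind fun r =>
      if r.1.isTrue then p.eval O x r.2 else q.eval O x r.2 :=
  eval_cond O x s.1 s.2 c p q

theorem eval_fold' (p : Prog) : (Prog.fold p).eval O x s =
    loop (p.eval O) x.fst.toList x.snd (s.1 + 1, s.2) :=
  eval_fold O x s.1 s.2 p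

end eval

section sim

variable {σ τ : Type} {C : Prog} {O : Oracle σ} {Q : Oracle τ} {φ : τ → Data × σ}

theorem sem_sim
    (h : ∀ i s d, C.sem O (.cons (φ s).1 d) (φ s).2 =
      (Q i s d).map fun r => (.cons (φ r.2).1 r.1, (φ r.2).2)) (p : Prog) :
    ∀ x s, (sim C p).sem O (.cons (φ s).1 x) (φ s).2 =
      (p.sem Q x s).map fun r => (.cons (φ r.2).1 r.1, (φ r.2).2) := by
  induction p with
  | nil | id | fst | snd =>
    intro x s
    simp [sim, sem, PMF.pure_bind, PMF.pure_map, Data.fst_cons, Data.snd_cons]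
  | coin =>
    intro x s
    simp [sim, sem, PMF.pure_bind, PMF.pure_map, PMF.map_bind, Data.fst_cons]
  | call i => intro x s; exact h i s x
  | pair p q ihp ihq =>
    intro x s
    simp [sim, exch, sem, PMF.pure_bind, PMF.pure_map, PMF.bind_map, PMF.map_bind, Data.fst_cons,
      Data.snd_cons, ihp, ihq, Function.comp_def]
  | seq p q ihp ihq =>
    intro x s
    simp [sim, sem, PMF.bind_map, PMF.map_bind, ihp, ihq, Function.comp_def]
  | cond c p q ihc ihp ihq =>
    intro x s
    simp only [sim, sem, PMF.pure_bind, PMF.bind_map, PMF.map_bind, PMF.bind_bind, Data.fst_cons,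
      Data.snd_cons, ihc, ihp, ihq, Function.comp_def]
    refine congrArg (PMF.bind _) (funext fun r => ?_)
    split <;> rfl
  | fold p ih =>
    intro x s
    simp only [sim, exch, sem, PMF.pure_bind, Data.fst_cons, Data.snd_cons]
    generalize x.fst.toList = l
    generalize x.snd = d
    induction l generalizing d s with
    | nil => simp [loop, PMF.pure_map]
    | cons a l ihl =>
      simp only [loop, Data.fst_cons, Data.snd_cons, ih, PMF.bind_map, PMF.map_bind,
        Function.comp_def]
      exact congrArg (PMF.bind _) (funext fun r => ihl r.2 r.1)

/-- Every run of a simulation comes from a run of the simulated program, whose number of steps is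
smaller by at most a constant factor. -/
theorem support_sim (K : ℕ)
    (h : ∀ i s d n, ∀ r ∈ (C.eval O (.cons (φ s).1 d) (n, (φ s).2)).support, r.2.1 ≤ n + K ∧
      ∃ r' ∈ (Q i s d).support, r.1 = .cons (φ r'.2).1 r'.1 ∧ r.2.2 = (φ r'.2).2)
    (p : Prog) : ∀ x s n n', ∀ r ∈ ((sim C p).eval O (.cons (φ s).1 x) (n, (φ s).2)).support,
      ∃ r' ∈ (p.eval Q x (n', s)).support, r.1 = .cons (φ r'.2.2).1 r'.1 ∧
        r.2.2 = (φ r'.2.2).2 ∧ r.2.1 + (K + 30) * n' + 10 ≤ n + (K + 30) * r'.2.1 := by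
  induction p with
  | nil | id | fst | snd =>
    intro x s n n' r hr
    simp only [sim, eval_pair', eval_seq', eval_fst', eval_snd', eval_nil', eval_id', PMF.pure_bind,
      PMF.mem_support_pure_iff, exists_eq_left, Data.fst_cons, Data.snd_cons] at hr ⊢
    subst hr
    refine ⟨rfl, rfl, ?_⟩
    simp only
    nlinarith
  | coin =>
    intro x s n n' r hr
    simp only [sim, eval_pair', eval_fst', eval_coin', PMF.pure_bind, PMF.bind_bind,
      PMF.mem_support_bind_iff, PMF.mem_support_pure_iff, Data.fst_cons] at hr ⊢
    obtain ⟨b, hb, rfl⟩ := hr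
    refine ⟨_, ⟨b, hb, rfl⟩, rfl, rfl, ?_⟩
    simp only
    nlinarith
  | call i =>
    intro x s n n' r hr
    obtain ⟨hK, r', hr', h₁, h₂⟩ := h i s x n r hr
    refine ⟨(r'.1, n' + 1, r'.2), ?_, h₁, h₂, ?_⟩
    · rw [eval_call, PMF.mem_support_bind_iff]
      exact ⟨r', hr', (PMF.mem_support_pure_iff _ _).2 rfl⟩
    · simp only
      nlinarith
  | pair p q ihp ihq =>
    intro x s n n' r hr
    simp only [sim, exch, eval_pair', eval_seq', eval_fst', eval_snd', PMF.pure_bind, PMF.bind_bind,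
      PMF.mem_support_bind_iff, PMF.mem_support_pure_iff, Data.fst_cons, Data.snd_cons] at hr ⊢
    obtain ⟨⟨a, n₁, s₁⟩, ha, ⟨b, n₂, s₂⟩, hb, rfl⟩ := hr
    obtain ⟨⟨a', n₁', s₁'⟩, ha', h₁, h₂, h₃⟩ := ihp _ _ _ (n' + 1) _ ha
    simp only at h₁ h₂ h₃
    subst h₁ h₂
    simp only [Data.fst_cons] at hb
    obtain ⟨⟨b', n₂', s₂'⟩, hb', h₄, h₅, h₆⟩ := ihq _ _ _ n₁' _ hb
    simp only at h₄ h₅ h₆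
    subst h₄ h₅
    refine ⟨_, ⟨_, ha', _, hb', rfl⟩, rfl, rfl, ?_⟩
    simp only
    nlinarith
  | seq p q ihp ihq =>
    intro x s n n' r hr
    simp only [sim, eval_seq', PMF.mem_support_bind_iff] at hr ⊢
    obtain ⟨⟨a, n₁, s₁⟩, ha, hr⟩ := hr
    obtain ⟨⟨a', n₁', s₁'⟩, ha', h₁, h₂, h₃⟩ := ihp _ _ _ (n' + 1) _ ha
    simp only at h₁ h₂ h₃
    subst h₁ h₂
    obtain ⟨r', hb', h₄, h₅, h₆⟩ := ihq _ _ _ n₁' _ hr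
    refine ⟨r', ⟨_, ha', hb'⟩, h₄, h₅, ?_⟩
    nlinarith
  | cond c p q ihc ihp ihq =>
    intro x s n n' r hr
    simp only [sim, eval_pair', eval_seq', eval_cond', eval_fst', eval_snd', PMF.pure_bind,
      PMF.bind_bind, PMF.mem_support_bind_iff, Data.fst_cons, Data.snd_cons] at hr ⊢
    obtain ⟨⟨a, n₁, s₁⟩, ha, hr⟩ := hr
    obtain ⟨⟨a', n₁', s₁'⟩, ha', h₁, h₂, h₃⟩ := ihc _ _ _ (n' + 1) _ ha
    simp only at h₁ h₂ h₃
    subst h₁ h₂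
    simp only [Data.fst_cons, Data.snd_cons] at hr
    by_cases hb : a'.isTrue
    · simp only [hb, if_true] at hr
      obtain ⟨r', hb', h₄, h₅, h₆⟩ := ihp _ _ _ n₁' _ hr
      refine ⟨r', ⟨_, ha', ?_⟩, h₄, h₅, by nlinarith⟩
      simpa only [hb, if_true] using hb'
    · simp only [hb] at hr
      obtain ⟨r', hb', h₄, h₅, h₆⟩ := ihq _ _ _ n₁' _ hr
      refine ⟨r', ⟨_, ha', ?_⟩, h₄, h₅, by nlinarith⟩
      simp only [hb]
      exact hb'
  | fold p ih =>
    intro x s n n' r hr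
    simp only [sim, exch, eval_pair', eval_seq', eval_fold', eval_fst', eval_snd', PMF.pure_bind,
      Data.fst_cons, Data.snd_cons] at hr ⊢
    generalize x.fst.toList = l at *
    generalize x.snd = d at *
    suffices H : ∀ m m', r ∈ (loop ((Prog.seq exch (sim C p)).eval O) l (.cons (φ s).1 d)
        (m, (φ s).2)).support → ∃ r' ∈ (loop (p.eval Q) l d (m', s)).support,
          r.1 = .cons (φ r'.2.2).1 r'.1 ∧ r.2.2 = (φ r'.2.2).2 ∧
            r.2.1 + (K + 30) * m' ≤ m + (K + 30) * r'.2.1 by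
      obtain ⟨r', hr', h₁, h₂, h₃⟩ := H _ (n' + 1) hr
      exact ⟨r', hr', h₁, h₂, by nlinarith⟩
    clear hr
    induction l generalizing d s with
    | nil =>
      intro m m' hr
      simp only [loop, PMF.mem_support_pure_iff, exists_eq_left] at hr ⊢
      subst hr
      exact ⟨rfl, rfl, le_rfl⟩
    | cons a l ihl =>
      intro m m' hr
      simp only [loop, PMF.mem_support_bind_iff] at hr ⊢
      obtain ⟨⟨b, n₁, s₁⟩, ha, hr⟩ := hr
      simp only [exch, eval_pair', eval_seq', eval_fst', eval_snd', PMF.pure_bind,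
        Data.fst_cons, Data.snd_cons] at ha
      obtain ⟨⟨b', n₁', s₁'⟩, ha', h₁, h₂, h₃⟩ := ih _ _ _ m' _ ha
      simp only at h₁ h₂ h₃
      subst h₁ h₂
      obtain ⟨r', hr', h₄, h₅, h₆⟩ := ihl _ _ _ n₁' hr
      exact ⟨r', ⟨_, ha', hr'⟩, h₄, h₅, by nlinarith⟩

end sim

end Prog

end

noncomputable section

namespace Prog

theorem mem_support_sem {σ : Type} {O : Oracle σ} {p : Prog} {x : Data} {s : ℕ × σ}
    {r : Data × ℕ × σ} (hr : r ∈ (p.eval O x s).support) :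
    (r.1, r.2.2) ∈ (p.sem O x s.2).support := by
  rw [← map_eval O p x s.1 s.2, PMF.mem_support_map_iff]
  exact ⟨r, hr, rfl⟩

theorem map_run {σ : Type} {α : Type} (O : Oracle σ) (p : Prog) (x : Data) (s : σ)
    (f : Data × σ → α) :
    (p.run O s x).map (fun r => f (r.1, r.2.2)) = (p.sem O x s).map f := by
  rw [← map_eval O p x 0 s, PMF.map_comp]
  rfl

end Prog

/-- The oracle that answers by a fixed function and lists the questions. -/
def recordOracle {κ : ℕ} (ans : Univ κ → Bool) : Oracle (List (Univ κ)) :=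
  fun _ qs d => PMF.pure (Data.ofBool (ans (Data.toBits κ d)), qs ++ [Data.toBits κ d])

/-- Do the first `c` bits of `π x` agree with those of `π a` for some `a` in the list? -/
def isPositive {κ : ℕ} (c : ℕ) (π : Equiv.Perm (Univ κ)) (l : List (Univ κ)) (x : Univ κ) : Bool :=
  l.any fun a => decide ((Data.ofBits (π a)).idx c = (Data.ofBits (π x)).idx c)

/-- The outcome of the adaptive game for a truncated permutation and a fixed set: what the
adversary returns and its queries. -/
def view {κ : ℕ} (c : ℕ) (A : Prog) (l : List (Univ κ)) (π : Equiv.Perm (Univ κ)) :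
    PMF (Data × List (Univ κ)) :=
  A.sem (recordOracle (isPositive c π l)) (.cons (.unary κ) (.ofElems l)) []

/-- The adversary obeys the rules and bets. -/
def IsBet {κ : ℕ} (t : ℕ) (l : List (Univ κ)) (r : Data × List (Univ κ)) : Prop :=
  r.1.fst.isTrue = true ∧ r.2.length ≤ t ∧ Data.toBits κ r.1.snd ∉ l ∧
    Data.toBits κ r.1.snd ∉ r.2

namespace Prog

/-- Ask the oracle for the images of a list of strings. -/
def imagesP {κ : ℕ} : List (Univ κ) → Prog
  | [] => .nil
  | x :: l => .pair (.seq (const (.ofBits x)) (.call 0)) (imagesP l)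

theorem imagesP_loopFree {κ : ℕ} (l : List (Univ κ)) : (imagesP l).LoopFree := by
  induction l with
  | nil => trivial
  | cons x l ih => exact ⟨⟨(const_plain _).loopFree, trivial⟩, ih⟩

theorem imagesP_size {κ : ℕ} (l : List (Univ κ)) :
    (imagesP l).size ≤ (4 * κ + 4) * l.length + 1 := by
  induction l with
  | nil => simp [imagesP, size]
  | cons x l ih =>
    have := const_ofBits_size x
    simp only [imagesP, size, List.length_cons]
    linarith

theorem imagesP_sem {κ : ℕ} (π : Equiv.Perm (Univ κ)) (l : List (Univ κ)) (x : Data) :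
    (imagesP l).sem (permOracle π) x () = PMF.pure (.ofElems (l.map π), ()) := by
  induction l with
  | nil => rfl
  | cons a l ih =>
    rw [imagesP, sem, sem, (const_plain _).sem_eq, PMF.pure_bind, const_fn, sem, permOracle,
      Data.toBits_ofBits]
    exact (PMF.pure_bind _ _).trans ((congrArg (fun p => PMF.bind p _) ih).trans
      (PMF.pure_bind _ _))

theorem memP_fn_mem (k j : ℕ) (x : Data) : (memP k j).fn x ∈ Set.range Data.ofBool := by
  induction k generalizing x with
  | zero => exact ⟨false, rfl⟩
  | succ k ih =>
    rw [memP, fn]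
    split
    · rw [fn]
      split
      · exact ⟨true, rfl⟩
      · exact ih _
    · exact ⟨false, rfl⟩

/-- The answer to a query of the adversary: it is computed from the image of the question, which
is added to the second part of the state; the first part of the state lists the images of the
elements of the set. -/
def answerP (n c : ℕ) : Prog :=
  .seq (.pair .fst (.seq .snd (.call 0)))
    (.pair (.pair (.seq .fst .fst) (.pair .snd (.seq .fst .snd)))
      (.seq (.pair (.seq .fst .fst) .snd) (memP n c)))

theorem answerP_loopFree (n c : ℕ) : (answerP n c).LoopFree := by
  simp [answerP, LoopFree, (memP_plain n c).loopFree]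

theorem answerP_size (n c : ℕ) : (answerP n c).size = (30 * c + 22) * n + 23 := by
  simp only [answerP, size, memP_size]
  ring

theorem answerP_sem {σ : Type} (O : Oracle σ) (n c : ℕ) (st d : Data) (s : σ) :
    (answerP n c).sem O (.cons st d) s = (O 0 s d).bind fun r =>
      PMF.pure (.cons (.cons st.fst (.cons r.1 st.snd)) ((memP n c).fn (.cons st.fst r.1)), r.2) := by
  simp only [answerP, sem, PMF.pure_bind, PMF.bind_bind, (memP_plain n c).sem_eq, Data.fst_cons,
    Data.snd_cons]

/-- The evaluation of the adversary's bet. -/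
def judgeP (κ n t c : ℕ) (b : Bool) : Prog :=
  .seq (.pair .id (.seq (.seq .snd .snd) (.call 0)))
    (.cond (.seq .fst (.seq .snd .fst))
      (.cond (.seq (.seq .fst (.seq .fst .snd)) (dropP t)) .nil
        (.cond (.seq (.pair (.seq .fst (.seq .fst .fst)) .snd) (memP n κ)) .nil
          (.cond (.seq (.pair (.seq .fst (.seq .fst .snd)) .snd) (memP t κ)) .nil
            (.cond (.seq (.pair (.seq .fst (.seq .fst .fst)) .snd) (memP n c))
              (const (.ofBool b)) (const (.ofBool !b))))))
      .nil)

theorem judgeP_loopFree (κ n t c : ℕ) (b : Bool) : (judgeP κ n t c b).LoopFree := by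
  simp [judgeP, LoopFree, (memP_plain _ _).loopFree, (dropP_plain _).loopFree,
    (const_plain _).loopFree]

theorem judgeP_size (κ n t c : ℕ) (b : Bool) : (judgeP κ n t c b).size ≤
    (30 * κ + 22) * n + (30 * κ + 22) * t + (30 * c + 22) * n + 2 * t + 70 := by
  have h₁ := const_ofBool_size b
  have h₂ := const_ofBool_size !b
  simp only [judgeP, size, memP_size, dropP_size]
  linarith

theorem judgeP_sem {κ : ℕ} (π : Equiv.Perm (Univ κ)) (n t c : ℕ) (b : Bool) (l : List (Univ κ))
    (hl : l.length ≤ n) (r : Data × List (Univ κ)) [Decidable (IsBet t l r)] :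
    (judgeP κ n t c b).sem (permOracle π)
      (.cons (.cons (.ofElems (l.map π)) (.ofElems (r.2.reverse.map π))) r.1) () =
    PMF.pure (.ofBool (decide (IsBet t l r ∧ isPositive c π l (Data.toBits κ r.1.snd) = b)), ()) := by
  obtain ⟨d, qs⟩ := r
  simp only at *
  rw [judgeP, sem]
  simp only [sem, PMF.pure_bind, Data.snd_cons, permOracle]
  refine (congrArg (fun p => PMF.bind p _) (PMF.pure_bind _ _)).trans ?_
  simp only [PMF.pure_bind]
  set x := Data.toBits κ d.snd with hx
  have hmem : ∀ (l' : List (Univ κ)),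
      (l'.map π).any (fun a => decide ((Data.ofBits a).idx κ = (Data.ofBits (π x)).idx κ)) =
        decide (x ∈ l') := by
    intro l'
    rw [Bool.eq_iff_iff]
    simp [Data.idx_ofBits_inj le_rfl]
  have hpos : (l.map π).any
      (fun a => decide ((Data.ofBits a).idx c = (Data.ofBits (π x)).idx c)) =
        isPositive c π l x := by
    rw [isPositive, List.any_map]
    rfl
  have hT : ∀ j, (memP n j).fn (.cons (.ofElems (l.map π)) (.ofBits (π x))) = _ :=
    fun j => memP_fn j _ _ n (by simpa using hl)
  have hdrop : ((dropP t).fn (.ofElems (qs.reverse.map π))).isTrue = decide (t < qs.length) := by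
    rw [Data.ofElems, dropP_isTrue]; simp
  simp only [(memP_plain _ _).sem_eq, (dropP_plain _).sem_eq, (const_plain _).sem_eq,
    PMF.pure_bind, Data.fst_cons, Data.snd_cons, hT, hmem, hpos, hdrop, Data.isTrue_ofBool,
    const_fn]
  have hbet : IsBet t l (d, qs) ↔
      d.fst.isTrue = true ∧ qs.length ≤ t ∧ x ∉ l ∧ x ∉ qs := Iff.rfl
  have hfalse (h : ¬IsBet t l (d, qs)) :
      decide (IsBet t l (d, qs) ∧ isPositive c π l x = b) = false :=
    decide_eq_false fun h' => h h'.1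
  by_cases h₁ : d.fst.isTrue = true
  · by_cases h₂ : t < qs.length
    · rw [hfalse (by rw [hbet]; exact fun h => absurd h₂ (not_lt.2 h.2.1))]
      simp [h₁, h₂, Data.ofBool]
    · have hL := memP_fn κ (qs.reverse.map π) (.ofBits (π x)) t (by simpa using h₂)
      rw [hmem] at hL
      rw [hL]
      by_cases h₃ : x ∈ l
      · rw [hfalse (by rw [hbet]; exact fun h => h.2.2.1 h₃)]
        simp [h₁, h₂, h₃, Data.ofBool]
      · by_cases h₄ : x ∈ qs
        · rw [hfalse (by rw [hbet]; exact fun h => h.2.2.2 h₄)]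
          simp [h₁, h₂, h₃, h₄, Data.ofBool]
        · have h₅ : IsBet t l (d, qs) := hbet.2 ⟨h₁, not_lt.1 h₂, h₃, h₄⟩
          simp only [h₁, h₂, h₃, h₅, true_and, Data.isTrue_ofBool]
          cases b <;> cases isPositive c π l x <;> simp [Data.ofBool, h₄]
  · rw [hfalse (by rw [hbet]; exact fun h => h₁ h.1)]
    simp [h₁, Data.ofBool]

/-- The distinguisher that plays the adaptive game against the adversary `A` for the set `l`. -/
def gameP {κ : ℕ} (n t c : ℕ) (b : Bool) (l : List (Univ κ)) (A : Prog) : Prog :=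
  .seq (.pair (.pair (imagesP l) .nil) (.pair .id (const (.ofElems l))))
    (.seq (sim (answerP n c) A) (judgeP κ n t c b))

open Classical in
theorem distinguish_gameP {κ : ℕ} (n t c : ℕ) (b : Bool) (l : List (Univ κ))
    (hl : l.length ≤ n) (A : Prog) (π : Equiv.Perm (Univ κ)) :
    distinguish (gameP n t c b l A) π = (view c A l π).map fun r =>
      decide (IsBet t l r ∧ isPositive c π l (Data.toBits κ r.1.snd) = b) := by
  rw [distinguish, map_run _ _ _ _ fun r => r.1.isTrue, gameP]
  simp only [sem, imagesP_sem, PMF.pure_bind, (const_plain _).sem_eq, const_fn]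
  let φ : List (Univ κ) → Data × Unit := fun qs =>
    (.cons (.ofElems (l.map π)) (.ofElems (qs.reverse.map π)), ())
  have h := sem_sim (C := answerP n c) (O := permOracle π)
    (Q := recordOracle (isPositive c π l)) (φ := φ) (fun i qs d => by
      rw [answerP_sem]
      refine (PMF.pure_bind _ _).trans ?_
      rw [recordOracle, PMF.pure_map]
      simp only [φ, Data.fst_cons, Data.snd_cons]
      rw [memP_fn c _ _ n (by simpa using hl), List.any_map]
      simp only [List.reverse_append, List.reverse_cons, List.reverse_nil, List.nil_append,
        List.cons_append, List.map_cons]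
      rfl) A (.cons (.unary κ) (.ofElems l)) []
  have h' : (sim (answerP n c) A).sem (permOracle π)
      (.cons (.cons (.ofElems (l.map π)) .nil) (.cons (.unary κ) (.ofElems l))) () = _ := h
  rw [h', PMF.bind_map, PMF.map_bind]
  simp only [Function.comp_def, φ, judgeP_sem π n t c b l hl, PMF.pure_map, Data.isTrue_ofBool]
  rfl

/-- A bound for the running time of `gameP`. -/
def gameBound (κ n t T : ℕ) : ℕ :=
  (140 * κ + 140) * n + (60 * κ + 60) * t + 300 + ((30 * κ + 22) * n + 60) * T

theorem gameP_runsWithin {κ : ℕ} (n t c : ℕ) (hc : c ≤ κ) (b : Bool) (l : List (Univ κ))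
    (hl : l.length ≤ n) (A : Prog) (T : ℕ)
    (hA : A.RunsWithin (Set.range Data.ofBool) (.cons (.unary κ) (.ofElems l)) T) (Ans : Set Data) :
    (gameP n t c b l A).RunsWithin Ans (.unary κ) (gameBound κ n t T) := by
  intro σ O _ s r hr
  let Q : Oracle (Data × σ) := fun _ st d =>
    ((answerP n c).sem O (.cons st.1 d) st.2).map fun r => (r.1.snd, (r.1.fst, r.2))
  have hQ : ∀ i st d, ∀ r ∈ (Q i st d).support, r.1 ∈ Set.range Data.ofBool := by
    intro i st d r hr
    rw [PMF.mem_support_map_iff] at hr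
    obtain ⟨r, hr, rfl⟩ := hr
    rw [answerP_sem, PMF.mem_support_bind_iff] at hr
    obtain ⟨r', _, hr⟩ := hr
    rw [PMF.mem_support_pure_iff] at hr
    subst hr
    exact memP_fn_mem _ _ _
  have hsim := support_sim (C := answerP n c) (O := O) (Q := Q) (φ := fun st => st)
    (answerP n c).size (fun i st d m r hr => by
      refine ⟨(answerP_loopFree n c).steps_le O _ _ _ r hr, _,
        (PMF.mem_support_map_iff _ _ _).2 ⟨_, mem_support_sem hr, rfl⟩, ?_, rfl⟩
      have hr := mem_support_sem hr
      rw [answerP_sem, PMF.mem_support_bind_iff] at hr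
      obtain ⟨r', _, hr⟩ := hr
      rw [PMF.mem_support_pure_iff] at hr
      simp only [Prod.mk.injEq] at hr
      rw [hr.1]
      rfl) A
  change r ∈ (PMF.support ((gameP n t c b l A).eval O (.unary κ) (0, s))) at hr
  rw [gameP, eval_seq, PMF.mem_support_bind_iff] at hr
  obtain ⟨⟨a₁, n₁, s₁⟩, h₁, hr⟩ := hr
  rw [eval_seq, PMF.mem_support_bind_iff] at hr
  obtain ⟨⟨a₂, n₂, s₂⟩, h₂, hr⟩ := hr
  have hn₁ := LoopFree.steps_le O
    (p := .pair (.pair (imagesP l) .nil) (.pair .id (const (.ofElems l))))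
    ⟨⟨imagesP_loopFree l, trivial⟩, trivial, (const_plain _).loopFree⟩ _ _ _ _ h₁
  have hn₃ := (judgeP_loopFree κ n t c b).steps_le O _ _ _ _ hr
  have ha₁ := mem_support_sem h₁
  simp only [sem, PMF.pure_bind, (const_plain _).sem_eq, const_fn, PMF.bind_bind,
    PMF.mem_support_bind_iff, PMF.mem_support_pure_iff, Prod.mk.injEq] at ha₁
  obtain ⟨w, _, ha₁, _⟩ := ha₁
  subst ha₁
  obtain ⟨r', hr', _, _, hn₂⟩ := hsim _ (.cons w.1 .nil, s₁) _ 0 _ h₂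
  have hT := hA _ Q hQ _ r' hr'
  have e₁ := answerP_size n c
  have e₂ := judgeP_size κ n t c b
  have e₃ := sim_size (answerP n c) A
  have e₄ := imagesP_size l
  have e₅ := const_ofElems_size l
  have e₆ : (4 * κ + 4) * l.length ≤ (4 * κ + 4) * n := Nat.mul_le_mul_left _ hl
  have e₇ : (4 * κ + 2) * l.length ≤ (4 * κ + 2) * n := Nat.mul_le_mul_left _ hl
  have e₈ : c * n ≤ κ * n := Nat.mul_le_mul_right _ hc
  have e₉ : ((answerP n c).size + 30) * (A.size + r'.2.1) ≤ ((30 * κ + 22) * n + 60) * T := by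
    refine Nat.mul_le_mul ?_ hT
    rw [e₁]
    linarith
  clear hA hQ hsim hr h₁ h₂ hr'
  generalize (answerP n c).size = u at *
  generalize A.size = v at *
  simp only [gameP, size, gameBound] at hn₁ hn₂ hn₃ ⊢
  generalize (imagesP l).size = a₁ at *
  generalize (const (Data.ofElems l)).size = a₂ at *
  generalize (judgeP κ n t c b).size = a₃ at *
  generalize r.2.1 = a₄ at *
  generalize r'.2.1 = a₅ at *
  generalize (sim (answerP n c) A).size = a₆ at *
  linarith

end Prog

end

section

noncomputable section

open scoped ENNReal

/-- The advantage of a distinguisher. -/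
def KeyedPerm.advantage (E : KeyedPerm) (κ : ℕ) (D : Prog) : ℝ :=
  |(((PMF.uniformOfFintype (Univ κ)).bind fun sk => distinguish D (E κ sk)) true).toReal
    - (((PMF.uniformOfFintype (Equiv.Perm (Univ κ))).bind fun π => distinguish D π) true).toReal|

theorem PMF.toReal_apply_mem_Icc {α : Type} (p : PMF α) (a : α) : (p a).toReal ∈ Set.Icc 0 1 :=
  ⟨ENNReal.toReal_nonneg, ENNReal.toReal_le_of_le_ofReal zero_le_one (by simpa using p.coe_le_one a)⟩

theorem KeyedPerm.advantage_le_one (E : KeyedPerm) (κ : ℕ) (D : Prog) : E.advantage κ D ≤ 1 := by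
  have h₁ := ((PMF.uniformOfFintype (Univ κ)).bind
    fun sk => distinguish D (E κ sk)).toReal_apply_mem_Icc true
  have h₂ := ((PMF.uniformOfFintype (Equiv.Perm (Univ κ))).bind
    fun π => distinguish D π).toReal_apply_mem_Icc true
  rw [advantage, abs_le]
  constructor <;> linarith [h₁.1, h₁.2, h₂.1, h₂.2]

/-- The advantage of all distinguishers within a polynomial time bound is bounded by one negligible
function. -/
theorem KeyedPerm.IsPRP.exists_negligible {E : KeyedPerm} (hE : E.IsPRP) (P : Polynomial ℕ) :
    ∃ ν : ℕ → ℝ, Negligible ν ∧ ∀ κ D,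
      D.RunsWithin (Set.range fun v : Univ κ => Data.ofBits v) (.unary κ) (P.eval κ) →
        E.advantage κ D ≤ ν κ := by
  have key : ∀ κ, ∃ D : Prog,
      D.RunsWithin (Set.range fun v : Univ κ => Data.ofBits v) (.unary κ) ((P + 2).eval κ) ∧
      ∀ D' : Prog, D'.RunsWithin (Set.range fun v : Univ κ => Data.ofBits v) (.unary κ) (P.eval κ) →
        E.advantage κ D' ≤ 2 * E.advantage κ D := by
    intro κ
    let A : Set ℝ := {a | ∃ D : Prog,
      D.RunsWithin (Set.range fun v : Univ κ => Data.ofBits v) (.unary κ) (P.eval κ) ∧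
        E.advantage κ D = a}
    have hA : BddAbove A := ⟨1, by rintro _ ⟨D, _, rfl⟩; exact E.advantage_le_one κ D⟩
    by_cases h : ∃ a ∈ A, 0 < a
    · obtain ⟨a, ha, ha₀⟩ := h
      have hs : 0 < sSup A := ha₀.trans_le (le_csSup hA ha)
      obtain ⟨_, ⟨D, hD, rfl⟩, hlt⟩ := exists_lt_of_lt_csSup ⟨a, ha⟩ (half_lt_self hs)
      refine ⟨D, fun σ O hO s r hr => (hD σ O hO s r hr).trans (by simp), fun D' hD' => ?_⟩
      linarith [le_csSup hA ⟨D', hD', rfl⟩]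
    · push Not at h
      refine ⟨.nil, fun σ O hO s r hr => ?_, fun D' hD' =>
        (h _ ⟨D', hD', rfl⟩).trans (mul_nonneg zero_le_two (abs_nonneg _))⟩
      have := Prog.LoopFree.steps_le O (p := .nil) trivial (.unary κ) 0 s r hr
      simp only [Prog.size] at this ⊢
      simp only [Polynomial.eval_add, Polynomial.eval_ofNat]
      omega
  choose D hD hD' using key
  exact ⟨_, (hE.2 D ⟨P + 2, hD⟩).const_mul 2, hD'⟩

namespace Prog

section locality

variable {α : Type} {κ : ℕ}

theorem recordOracle_extends {ans : Univ κ → Bool} (p : Prog) : ∀ (x : Data) (qs : List (Univ κ)),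
    ∀ r ∈ (p.sem (recordOracle ans) x qs).support, qs ⊆ r.2 := by
  have bind_ext : ∀ {qs : List (Univ κ)} {f : PMF (Data × List (Univ κ))}
      {g : Data × List (Univ κ) → PMF (Data × List (Univ κ))},
      (∀ r ∈ f.support, qs ⊆ r.2) → (∀ r, ∀ r' ∈ (g r).support, r.2 ⊆ r'.2) →
        ∀ r ∈ (f.bind g).support, qs ⊆ r.2 := by
    intro qs f g hf hg r hr
    rw [PMF.mem_support_bind_iff] at hr
    obtain ⟨a, ha, hr⟩ := hr
    exact List.Subset.trans (hf a ha) (hg a r hr)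
  have pure_ext : ∀ (y : Data) (qs : List (Univ κ)), ∀ r ∈ (PMF.pure (y, qs)).support, qs ⊆ r.2 := by
    intro y qs r hr
    rw [PMF.mem_support_pure_iff] at hr
    subst hr
    exact List.Subset.refl _
  induction p with
  | nil | id | fst | snd => intro x qs; exact pure_ext _ _
  | coin =>
    intro x qs r hr
    rw [sem, PMF.mem_support_bind_iff] at hr
    obtain ⟨b, _, hr⟩ := hr
    exact pure_ext _ _ r hr
  | call i =>
    intro x qs r hr
    rw [sem, recordOracle, PMF.mem_support_pure_iff] at hr
    subst hr
    exact List.subset_append_left _ _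
  | pair p q ihp ihq =>
    intro x qs
    exact bind_ext (ihp x qs) fun r => bind_ext (ihq x r.2) fun r' => pure_ext _ _
  | seq p q ihp ihq => intro x qs; exact bind_ext (ihp x qs) fun r => ihq r.1 r.2
  | cond c p q ihc ihp ihq =>
    intro x qs
    refine bind_ext (ihc x qs) fun r => ?_
    split
    exacts [ihp _ _, ihq _ _]
  | fold p ih =>
    intro x qs
    rw [sem]
    generalize x.fst.toList = l
    generalize x.snd = d
    induction l generalizing d qs with
    | nil => exact pure_ext _ _
    | cons a l ihl => exact bind_ext (ih _ _) fun r => ihl _ _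

/-- The probability of an outcome depends only on the answers to the listed questions. -/
theorem recordOracle_congr {ans ans' : Univ κ → Bool} (p : Prog) :
    ∀ (x : Data) (qs : List (Univ κ)) (r : Data × List (Univ κ)), (∀ q ∈ r.2, ans q = ans' q) →
      p.sem (recordOracle ans) x qs r = p.sem (recordOracle ans') x qs r := by
  have bind_congr : ∀ {f f' : PMF (Data × List (Univ κ))}
      {g g' : Data × List (Univ κ) → PMF (Data × List (Univ κ))},
      (∀ r, (∀ q ∈ r.2, ans q = ans' q) → f r = f' r) →
      (∀ r, ∀ r' ∈ (g r).support, r.2 ⊆ r'.2) → (∀ r, ∀ r' ∈ (g' r).support, r.2 ⊆ r'.2) →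
      (∀ r r', (∀ q ∈ r'.2, ans q = ans' q) → g r r' = g' r r') →
      ∀ r, (∀ q ∈ r.2, ans q = ans' q) → f.bind g r = f'.bind g' r := by
    intro f f' g g' hf hg hg' hgg r hr
    rw [PMF.bind_apply, PMF.bind_apply]
    refine tsum_congr fun a => ?_
    by_cases h : a.2 ⊆ r.2
    · rw [hf a fun q hq => hr q (h hq), hgg a r hr]
    · rw [(PMF.apply_eq_zero_iff _ _).2 fun h' => h (hg a r h'),
        (PMF.apply_eq_zero_iff _ _).2 fun h' => h (hg' a r h'), mul_zero, mul_zero]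
  have pure_ext : ∀ (y : Data) (qs : List (Univ κ)), ∀ r ∈ (PMF.pure (y, qs)).support, qs ⊆ r.2 := by
    intro y qs r hr
    rw [PMF.mem_support_pure_iff] at hr
    subst hr
    exact List.Subset.refl _
  have pair_ext : ∀ {ans : Univ κ → Bool} (q : Prog) (x y : Data) (qs : List (Univ κ)),
      ∀ r ∈ ((q.sem (recordOracle ans) x qs).bind fun r' =>
        PMF.pure (Data.cons y r'.1, r'.2)).support, qs ⊆ r.2 := by
    intro ans q x y qs r hr
    rw [PMF.mem_support_bind_iff] at hr
    obtain ⟨r', h₁, h₂⟩ := hr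
    exact List.Subset.trans (recordOracle_extends q x qs r' h₁) (pure_ext _ _ r h₂)
  induction p with
  | nil | id | fst | snd | coin => intro x qs r _; rfl
  | call i =>
    intro x qs r hr
    rw [sem, sem, recordOracle, recordOracle]
    by_cases h : Data.toBits κ x ∈ r.2
    · rw [hr _ h]
    · rw [PMF.pure_apply_of_ne, PMF.pure_apply_of_ne]
      all_goals
        rintro rfl
        exact h (by simp)
  | pair p q ihp ihq =>
    intro x qs
    exact bind_congr (ihp x qs) (fun r => pair_ext q x r.1 r.2) (fun r => pair_ext q x r.1 r.2)
      fun r => bind_congr (ihq x r.2) (fun r' => pure_ext _ _) (fun r' => pure_ext _ _)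
        fun _ _ _ => rfl
  | seq p q ihp ihq =>
    intro x qs
    exact bind_congr (ihp x qs) (fun r => recordOracle_extends q _ _)
      (fun r => recordOracle_extends q _ _) fun r => ihq r.1 r.2
  | cond c p q ihc ihp ihq =>
    intro x qs
    refine bind_congr (ihc x qs) (fun r => ?_) (fun r => ?_) fun r => ?_
    all_goals split
    exacts [recordOracle_extends p _ _, recordOracle_extends q _ _, recordOracle_extends p _ _,
      recordOracle_extends q _ _, ihp _ _, ihq _ _]
  | fold p ih =>
    intro x qs
    rw [sem, sem]
    generalize x.fst.toList = l
    generalize x.snd = d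
    have loop_ext : ∀ {ans : Univ κ → Bool} (l : List Data) (d : Data) (qs : List (Univ κ)),
        ∀ r ∈ (loop (p.sem (recordOracle ans)) l d qs).support, qs ⊆ r.2 := by
      intro ans l d qs r hr
      refine recordOracle_extends (ans := ans) (.fold p) (.cons (.ofList l) d) qs r ?_
      rw [sem, Data.fst_cons, Data.toList_ofList, Data.snd_cons]
      exact hr
    induction l generalizing d qs with
    | nil => intro r _; rfl
    | cons a l ihl =>
      exact bind_congr (ih _ _) (fun r => loop_ext _ _ _) (fun r => loop_ext _ _ _)
        fun r => ihl r.2 r.1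

end locality

end Prog

theorem PMF.map_decide_true {α : Type} (p : PMF α) (Q : α → Prop) [DecidablePred Q] :
    (p.map fun a => decide (Q a)) true = ∑' a, if Q a then p a else 0 := by
  rw [PMF.map_apply]
  refine tsum_congr fun a => ?_
  by_cases h : Q a <;> simp [h]

theorem list_any_congr {α : Type} {l : List α} {f g : α → Bool} (h : ∀ a ∈ l, f a = g a) :
    l.any f = l.any g := by
  induction l with
  | nil => rfl
  | cons a l ih =>
    rw [List.any_cons, List.any_cons, h a (by simp), ih fun b hb => h b (by simp [hb])]

section ideal

variable {κ : ℕ}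

theorem view_swap (c : ℕ) (A : Prog) (l : List (Univ κ)) (π : Equiv.Perm (Univ κ))
    (r : Data × List (Univ κ)) {x z : Univ κ} (hxl : x ∉ l) (hxr : x ∉ r.2) (hzl : z ∉ l)
    (hzr : z ∉ r.2) : view c A l (π * Equiv.swap x z) r = view c A l π r := by
  refine Prog.recordOracle_congr A _ _ _ fun q hq => ?_
  have h : ∀ y, y ≠ x → y ≠ z → (π * Equiv.swap x z) y = π y := fun y h₁ h₂ => by
    rw [Equiv.Perm.mul_apply, Equiv.swap_apply_of_ne_of_ne h₁ h₂]
  rw [isPositive, isPositive, h q (fun h => hxr (h ▸ hq)) (fun h => hzr (h ▸ hq))]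
  refine list_any_congr fun a ha => ?_
  rw [h a (fun h => hxl (h ▸ ha)) (fun h => hzl (h ▸ ha))]

theorem isPositive_swap (c : ℕ) (l : List (Univ κ)) (π : Equiv.Perm (Univ κ))
    {x z : Univ κ} (hxl : x ∉ l) (hzl : z ∉ l) :
    isPositive c (π * Equiv.swap x z) l x = isPositive c π l z := by
  rw [isPositive, isPositive, Equiv.Perm.mul_apply, Equiv.swap_apply_left]
  refine list_any_congr fun a ha => ?_
  have hax : a ≠ x := fun h => hxl (h ▸ ha)
  have haz : a ≠ z := fun h => hzl (h ▸ ha)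
  rw [Equiv.Perm.mul_apply, Equiv.swap_apply_of_ne_of_ne hax haz]

theorem card_isPositive_le {c : ℕ} (hc : c ≤ κ) (π : Equiv.Perm (Univ κ)) (l : List (Univ κ)) :
    (Finset.univ.filter fun z => isPositive c π l z = true).card ≤ l.length * 2 ^ (κ - c) := by
  induction l with
  | nil => simp [isPositive]
  | cons a l ih =>
    have h : (Finset.univ.filter fun z => isPositive c π (a :: l) z = true) ⊆
        ((Finset.univ.filter fun v : Univ κ =>
          (Data.ofBits v).idx c = (Data.ofBits (π a)).idx c).map π.symm.toEmbedding) ∪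
        (Finset.univ.filter fun z => isPositive c π l z = true) := by
      intro z hz
      simp only [Finset.mem_filter, Finset.mem_univ, true_and,
        Finset.mem_union, Finset.mem_map_equiv,
        Equiv.symm_symm] at hz ⊢
      rw [isPositive, List.any_cons, Bool.or_eq_true, decide_eq_true_eq] at hz
      exact hz.imp_left Eq.symm
    refine (Finset.card_le_card h).trans ((Finset.card_union_le _ _).trans ?_)
    rw [Finset.card_map, List.length_cons, add_mul, one_mul, add_comm]
    exact Nat.add_le_add ih (Data.card_idx_fiber_le hc _)

theorem sum_view_isPositive_le {c t : ℕ} (hc : c ≤ κ) (A : Prog) (l : List (Univ κ)) (ρ : ℝ≥0∞)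
    (hlt : l.length + t < 2 ^ κ)
    (hρ : ((l.length * 2 ^ (κ - c) : ℕ) : ℝ≥0∞) ≤ ρ * ((2 ^ κ - (l.length + t) : ℕ) : ℝ≥0∞))
    (r : Data × List (Univ κ)) (hr : IsBet t l r) :
    ∑ π : Equiv.Perm (Univ κ),
      (if isPositive c π l (Data.toBits κ r.1.snd) = true then view c A l π r else 0) ≤
      ρ * ∑ π : Equiv.Perm (Univ κ), view c A l π r := by
  obtain ⟨-, hrt, hxl, hxr⟩ := hr
  set x := Data.toBits κ r.1.snd
  set Z : Finset (Univ κ) := Finset.univ \ (l ++ r.2).toFinset with hZ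
  have hZmem : ∀ z ∈ Z, z ∉ l ∧ z ∉ r.2 := by
    intro z hz
    simpa [hZ] using hz
  have hZcard : 2 ^ κ - (l.length + t) ≤ Z.card := by
    have h₁ := Finset.le_card_sdiff (l ++ r.2).toFinset (Finset.univ : Finset (Univ κ))
    have h₂ := List.toFinset_card_le (l ++ r.2)
    have h₃ : (Finset.univ : Finset (Univ κ)).card = 2 ^ κ := by simp
    rw [List.length_append] at h₂
    rw [h₃, ← hZ] at h₁
    omega
  have hswap : ∀ z ∈ Z, ∑ π : Equiv.Perm (Univ κ),
      (if isPositive c π l x = true then view c A l π r else 0) =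
      ∑ π : Equiv.Perm (Univ κ), (if isPositive c π l z = true then view c A l π r else 0) := by
    intro z hz
    obtain ⟨hzl, hzr⟩ := hZmem z hz
    rw [← Equiv.sum_comp (Equiv.mulRight (Equiv.swap x z))]
    refine Finset.sum_congr rfl fun π _ => ?_
    rw [Equiv.coe_mulRight, isPositive_swap c l π hxl hzl, view_swap c A l π r hxl hxr hzl hzr]
  have hsum : (Z.card : ℝ≥0∞) * ∑ π : Equiv.Perm (Univ κ),
      (if isPositive c π l x = true then view c A l π r else 0) ≤
      ((l.length * 2 ^ (κ - c) : ℕ) : ℝ≥0∞) * ∑ π : Equiv.Perm (Univ κ), view c A l π r := by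
    rw [← nsmul_eq_mul, ← Finset.sum_const, Finset.sum_congr rfl hswap, Finset.sum_comm,
      Finset.mul_sum]
    refine Finset.sum_le_sum fun π _ => ?_
    rw [← Finset.sum_filter, Finset.sum_const, nsmul_eq_mul]
    gcongr
    exact (Finset.card_le_card (Finset.filter_subset_filter _ (Finset.subset_univ _))).trans
      (card_isPositive_le hc π l)
  have hN : ((2 ^ κ - (l.length + t) : ℕ) : ℝ≥0∞) ≠ 0 := by
    rw [Nat.cast_ne_zero]
    omega
  rw [← ENNReal.mul_le_mul_iff_right hN (ENNReal.natCast_ne_top _)]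
  calc _ ≤ (Z.card : ℝ≥0∞) * _ := by gcongr
    _ ≤ _ := hsum
    _ ≤ ρ * ((2 ^ κ - (l.length + t) : ℕ) : ℝ≥0∞) * _ := by gcongr
    _ = _ := by ring

/-- Against a truly random permutation, a bet is won with probability at most `ρ`. -/
theorem ideal_win_le {c t : ℕ} (hc : c ≤ κ) (A : Prog) (l : List (Univ κ)) (ρ : ℝ≥0∞)
    (hlt : l.length + t < 2 ^ κ)
    (hρ : ((l.length * 2 ^ (κ - c) : ℕ) : ℝ≥0∞) ≤ ρ * ((2 ^ κ - (l.length + t) : ℕ) : ℝ≥0∞))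
    (w : Bool → ℝ≥0∞)
    (hw : ∀ b, w b = ((PMF.uniformOfFintype (Equiv.Perm (Univ κ))).bind fun π =>
      distinguish (Prog.gameP l.length t c b l A) π) true) :
    w true ≤ ρ * (w true + w false) := by
  classical
  have hb : ∀ b, w b = ∑' r, if IsBet t l r then ∑ π : Equiv.Perm (Univ κ),
      (Fintype.card (Equiv.Perm (Univ κ)) : ℝ≥0∞)⁻¹ *
        (if isPositive c π l (Data.toBits κ r.1.snd) = b then view c A l π r else 0) else 0 := by
    intro b
    rw [hw, PMF.bind_apply, tsum_fintype]
    simp only [Prog.distinguish_gameP _ _ _ _ _ le_rfl, PMF.uniformOfFintype_apply,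
      PMF.map_decide_true, ← ENNReal.tsum_mul_left]
    rw [← tsum_fintype (L := .unconditional _), ENNReal.tsum_comm]
    refine tsum_congr fun r => ?_
    rw [tsum_fintype]
    by_cases h : IsBet t l r
    · simp only [h, true_and, if_true]
    · simp [h]
  rw [hb, hb, ← ENNReal.tsum_add, ← ENNReal.tsum_mul_left]
  refine ENNReal.tsum_le_tsum fun r => ?_
  by_cases h : IsBet t l r
  · simp only [h, if_true, ← Finset.mul_sum]
    rw [← mul_add, mul_left_comm]
    gcongr
    refine (sum_view_isPositive_le hc A l ρ hlt hρ r h).trans_eq ?_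
    rw [← Finset.sum_add_distrib]
    congr 1
    refine Finset.sum_congr rfl fun π _ => ?_
    cases isPositive c π l (Data.toBits κ r.1.snd) <;> simp
  · simp [h]

end ideal

end

end

section

noncomputable section

open scoped ENNReal

/-- The standard Bloom filter with one hash function, truncation to `c` bits. -/
def truncationBloom (c : ℕ) : StandardBloom where
  m _ := 2 ^ c
  m_pos _ := by positivity
  k _ := 1
  hash _ _ x := ⟨(Data.ofBits x).idx c, Data.idx_lt _ _⟩

section betTest

variable {κ : ℕ}

open Classical in
/-- The evaluation of a bet. -/
def verdict (c t : ℕ) (l : List (Univ κ)) (π : Equiv.Perm (Univ κ))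
    (r : Data × List (Univ κ)) : BetResult :=
  if IsBet t l r then
    if isPositive c π l (Data.toBits κ r.1.snd) then .win else .lose
  else .pass

/-- The Bet-or-Pass test for a fixed set and a random permutation, truncated to `c` bits. -/
def betTest (Pi : PMF (Equiv.Perm (Univ κ))) (c t : ℕ) (l : List (Univ κ)) (A : Prog) :
    PMF BetResult :=
  Pi.bind fun π => (view c A l π).map (verdict c t l π)

theorem betTest_apply (Pi : PMF (Equiv.Perm (Univ κ))) (c t : ℕ) (l : List (Univ κ)) (A : Prog)
    (b : Bool) : betTest Pi c t l A (if b then .win else .lose) =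
      (Pi.bind fun π => distinguish (Prog.gameP l.length t c b l A) π) true := by
  classical
  rw [betTest, PMF.bind_apply, PMF.bind_apply]
  refine tsum_congr fun π => congrArg _ ?_
  rw [Prog.distinguish_gameP _ _ _ _ _ le_rfl, PMF.map_decide_true, PMF.map_apply]
  refine tsum_congr fun r => ?_
  rw [verdict]
  by_cases h : IsBet t l r
  · cases b <;> cases isPositive c π l (Data.toBits κ r.1.snd) <;> simp [h]
  · cases b <;> simp [h]

theorem win_add_lose_le (p : PMF BetResult) : (p .win).toReal + (p .lose).toReal ≤ 1 := by
  classical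
  rw [← ENNReal.toReal_add (p.apply_ne_top _) (p.apply_ne_top _)]
  refine ENNReal.toReal_le_of_le_ofReal zero_le_one ?_
  rw [ENNReal.ofReal_one, ← p.tsum_coe]
  have := ENNReal.sum_le_tsum (f := p) {.win, .lose}
  rwa [Finset.sum_pair (by simp)] at this

/-- Against a truncated pseudo-random permutation, the probabilities of winning and losing a bet
are close to those of a game in which a bet is won with probability at most `ρ`. -/
theorem exists_ideal_game (E : KeyedPerm) {ν : ℝ} {c t T : ℕ} (hc : c ≤ κ) (A : Prog)
    (l : List (Univ κ)) {ρ : ℝ} (hρ : 0 ≤ ρ) (hlc : 2 * (l.length : ℝ) ≤ ρ * 2 ^ c)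
    (hlt : 2 * (l.length + t) ≤ 2 ^ κ)
    (hA : A.RunsWithin (Set.range Data.ofBool) (.cons (.unary κ) (.ofElems l)) T)
    (hν : ∀ D : Prog, D.RunsWithin (Set.range fun v : Univ κ => Data.ofBits v) (.unary κ)
      (Prog.gameBound κ l.length t T) → E.advantage κ D ≤ ν) :
    ∃ p : PMF BetResult, (p .win).toReal ≤ ρ * ((p .win).toReal + (p .lose).toReal) ∧
      |(betTest ((PMF.uniformOfFintype (Univ κ)).map (E κ)) c t l A .win).toReal
        - (p .win).toReal| ≤ ν ∧
      |(betTest ((PMF.uniformOfFintype (Univ κ)).map (E κ)) c t l A .lose).toReal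
        - (p .lose).toReal| ≤ ν := by
  let p := betTest (PMF.uniformOfFintype (Equiv.Perm (Univ κ))) c t l A
  have hwin := betTest_apply (PMF.uniformOfFintype (Equiv.Perm (Univ κ))) c t l A
  have hwin' := betTest_apply ((PMF.uniformOfFintype (Univ κ)).map (E κ)) c t l A
  have hadv (b : Bool) :
      |(betTest ((PMF.uniformOfFintype (Univ κ)).map (E κ)) c t l A
          (if b then .win else .lose)).toReal - (p (if b then .win else .lose)).toReal| ≤ ν := by
    rw [hwin, hwin', PMF.bind_map]
    exact hν _ (Prog.gameP_runsWithin l.length t c hc b l le_rfl A T hA _)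
  refine ⟨p, ?_, hadv true, hadv false⟩
  have h2 : (0 : ℕ) < 2 ^ κ := by positivity
  have hle := ideal_win_le hc A l (ENNReal.ofReal ρ) (by omega) ?_
    (fun b => p (if b then .win else .lose)) hwin
  · have h := ENNReal.toReal_mono
      (ENNReal.mul_ne_top ENNReal.ofReal_ne_top
        (ENNReal.add_ne_top.2 ⟨p.apply_ne_top _, p.apply_ne_top _⟩)) hle
    rwa [ENNReal.toReal_mul, ENNReal.toReal_add (p.apply_ne_top _) (p.apply_ne_top _),
      ENNReal.toReal_ofReal hρ] at h
  · rw [← ENNReal.ofReal_natCast, ← ENNReal.ofReal_natCast, ← ENNReal.ofReal_mul hρ]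
    refine ENNReal.ofReal_le_ofReal ?_
    rw [Nat.cast_sub (by omega)]
    push_cast
    have hpow : (2 : ℝ) ^ κ = 2 ^ c * 2 ^ (κ - c) := by rw [← pow_add, Nat.add_sub_cancel' hc]
    have h₁ : 2 * ((l.length : ℝ) + t) ≤ 2 ^ κ := by exact_mod_cast hlt
    have h₂ : (0 : ℝ) < 2 ^ (κ - c) := by positivity
    have h₃ : 2 * (l.length : ℝ) * 2 ^ (κ - c) ≤ ρ * 2 ^ κ := by
      rw [hpow, ← mul_assoc]
      exact mul_le_mul_of_nonneg_right hlc h₂.le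
    nlinarith

end betTest

/-! ### Expected profits -/

theorem expectedProfit_eq (ε : ℝ) (p : PMF BetResult) :
    expectedProfit ε p = (p .win).toReal / ε - (p .lose).toReal / (1 - ε) := by
  simp only [expectedProfit, BetResult.profit]
  ring

theorem PMF.bind_apply_le {α β : Type} (p : PMF α) (f : α → PMF β) (b : β) {x : ℝ}
    (hx : 0 ≤ x) (h : ∀ a, (f a b).toReal ≤ x) : (p.bind f b).toReal ≤ x := by
  refine ENNReal.toReal_le_of_le_ofReal hx ?_
  rw [PMF.bind_apply]
  calc ∑' a, p a * f a b ≤ ∑' a, p a * ENNReal.ofReal x := by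
        refine ENNReal.tsum_le_tsum fun a => ?_
        gcongr
        exact (ENNReal.le_ofReal_iff_toReal_le ((f a).apply_ne_top b) hx).2 (h a)
    _ = ENNReal.ofReal x := by rw [ENNReal.tsum_mul_right, p.tsum_coe, one_mul]

theorem expectedProfit_bind_le {α : Type} {ε : ℝ} (hε₁ : ε < 1) (p : PMF α)
    (f : α → PMF BetResult) {x : ℝ} (hx : 0 ≤ x) (h : ∀ a, expectedProfit ε (f a) ≤ x) :
    expectedProfit ε (p.bind f) ≤ x := by
  have h₁ : 0 < 1 - ε := by linarith
  have key (q : PMF BetResult) : expectedProfit ε q ≤ x ↔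
      q .win * ENNReal.ofReal (1 / ε) ≤
        ENNReal.ofReal x + q .lose * ENNReal.ofReal (1 / (1 - ε)) := by
    rw [expectedProfit_eq, sub_le_iff_le_add, ← ENNReal.ofReal_toReal (q.apply_ne_top .win),
      ← ENNReal.ofReal_toReal (q.apply_ne_top .lose),
      ← ENNReal.ofReal_mul ENNReal.toReal_nonneg, ← ENNReal.ofReal_mul ENNReal.toReal_nonneg,
      ← ENNReal.ofReal_add hx (by positivity), ENNReal.ofReal_le_ofReal_iff (by positivity),
      ENNReal.toReal_ofReal ENNReal.toReal_nonneg, ENNReal.toReal_ofReal ENNReal.toReal_nonneg,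
      mul_one_div, mul_one_div]
  rw [key, PMF.bind_apply, PMF.bind_apply, ← ENNReal.tsum_mul_right, ← ENNReal.tsum_mul_right]
  calc ∑' a, p a * f a .win * ENNReal.ofReal (1 / ε)
      ≤ ∑' a, (p a * ENNReal.ofReal x + p a * f a .lose * ENNReal.ofReal (1 / (1 - ε))) := by
        refine ENNReal.tsum_le_tsum fun a => ?_
        rw [mul_assoc, mul_assoc, ← mul_add]
        gcongr
        exact (key _).1 (h a)
    _ = _ := by rw [ENNReal.tsum_add, ENNReal.tsum_mul_right, p.tsum_coe, one_mul]

theorem expectedProfit_le {ε : ℝ} (hε₀ : 0 < ε) (hε₁ : ε < 1) (p : PMF BetResult) :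
    expectedProfit ε p ≤ 1 / ε := by
  have h₁ : 0 < 1 - ε := by linarith
  have h₂ := (p.toReal_apply_mem_Icc .win).2
  have h₃ := (p.toReal_apply_mem_Icc .lose).1
  rw [expectedProfit_eq]
  have h₄ : 0 ≤ (p .lose).toReal / (1 - ε) := by positivity
  have h₅ : (p .win).toReal / ε ≤ 1 / ε := by gcongr
  linarith

/-- A bet that is won with probability at most `ε` brings no profit; deviations of the
probabilities bring little. -/
theorem expectedProfit_le_of_close {ε ν : ℝ} (hε₀ : 0 < ε) (hε₁ : ε < 1) (p q : PMF BetResult)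
    (hp : (p .win).toReal ≤ ε * ((p .win).toReal + (p .lose).toReal))
    (hw : |(q .win).toReal - (p .win).toReal| ≤ ν)
    (hl : |(q .lose).toReal - (p .lose).toReal| ≤ ν) :
    expectedProfit ε q ≤ (1 / ε + 1 / (1 - ε)) * ν := by
  have h₁ : 0 < 1 - ε := by linarith
  rw [abs_le] at hw hl
  have h₂ : (p .win).toReal / ε ≤ (p .lose).toReal / (1 - ε) := by
    rw [div_le_div_iff₀ hε₀ h₁]
    linarith
  have h₃ : (q .win).toReal / ε ≤ (p .win).toReal / ε + ν / ε := by
    rw [← add_div]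
    gcongr
    linarith
  have h₄ : (p .lose).toReal / (1 - ε) ≤ (q .lose).toReal / (1 - ε) + ν / (1 - ε) := by
    rw [← add_div]
    gcongr
    linarith
  rw [expectedProfit_eq, add_mul, one_div_mul_eq_div, one_div_mul_eq_div]
  linarith

/-! ### The tests of the key-storing filter -/

namespace Prog

theorem bind_run {σ : Type} {α : Type} (O : Oracle σ) (p : Prog) (x : Data) (s : σ)
    (f : Data × σ → PMF α) :
    (p.run O s x).bind (fun r => f (r.1, r.2.2)) = (p.sem O x s).bind f := by
  rw [← map_eval O p x 0 s, PMF.bind_map]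
  rfl

end Prog

theorem PMF.monad_bind_eq_bind {α β : Type} (p : PMF α) (f : α → PMF β) : p >>= f = p.bind f := rfl

theorem PMF.monad_pure_eq_pure {α : Type} (a : α) : (Pure.pure a : PMF α) = PMF.pure a := rfl

section tests

variable (E : KeyedPerm) (c : ℕ) {κ : ℕ}

theorem lookup_array (π : Equiv.Perm (Univ κ)) (l : List (Univ κ)) (x : Univ κ) :
    (truncationBloom c).lookup κ ((truncationBloom c).array κ (l.toFinset.image π)) (π x) =
      isPositive c π l x := by
  rw [Bool.eq_iff_iff]
  simp only [StandardBloom.lookup, StandardBloom.array, truncationBloom, isPositive,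
    decide_eq_true_eq, List.any_eq_true, Finset.mem_image, List.mem_toFinset, Fin.mk.injEq,
    forall_const, exists_const]
  constructor
  · rintro ⟨_, ⟨a, ha, rfl⟩, h⟩
    exact ⟨a, ha, h⟩
  · rintro ⟨a, ha, h⟩
    exact ⟨_, ⟨a, ha, rfl⟩, h⟩

/-- The representation of a set under a key. -/
def keyedRep (sk : Univ κ) (l : List (Univ κ)) : (keyStoringNY E (truncationBloom c)).Rep κ :=
  (sk, (truncationBloom c).array κ (l.toFinset.image (E κ sk)))

theorem build_eq (l : List (Univ κ)) : (keyStoringNY E (truncationBloom c)).build κ l.toFinset =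
    (PMF.uniformOfFintype (Univ κ)).bind fun sk => PMF.pure (keyedRep E c sk l) := rfl

theorem query_keyedRep (sk : Univ κ) (l : List (Univ κ)) (x : Univ κ) :
    (keyStoringNY E (truncationBloom c)).query κ (keyedRep E c sk l) x =
      PMF.pure (isPositive c (E κ sk) l x) :=
  congrArg PMF.pure (lookup_array c (E κ sk) l x)

theorem queryOracle_eq (sk : Univ κ) (l : List (Univ κ)) :
    (keyStoringNY E (truncationBloom c)).queryOracle κ (keyedRep E c sk l) =
    recordOracle (isPositive c (E κ sk) l) := by
  funext i qs d
  rw [InsertableFilter.queryOracle, query_keyedRep]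
  exact PMF.pure_bind _ _

/-- The Bet-or-Pass test is the test for the fixed set that the first adversary chooses. -/
theorem bpTest_eq (n t : ℕ) (A₁ A₂ : Prog) :
    (keyStoringNY E (truncationBloom c)).bpTest κ n t A₁ A₂ =
      (A₁.runPlain (.unary κ)).bind fun a =>
        if (Data.toElems κ a.1).length = n then
          betTest ((PMF.uniformOfFintype (Univ κ)).map (E κ)) c t (Data.toElems κ a.1) A₂
        else PMF.pure .pass := by
  simp only [InsertableFilter.bpTest, InsertableFilter.adaptiveGame, PMF.monad_bind_eq_bind,
    PMF.monad_pure_eq_pure, PMF.bind_bind, PMF.pure_bind]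
  refine congrArg (PMF.bind _) (funext fun a => ?_)
  set l := Data.toElems κ a.1
  by_cases hl : l.length = n
  · rw [if_pos hl, betTest, PMF.bind_map, build_eq, PMF.bind_bind]
    refine congrArg (PMF.bind _) (funext fun sk => ?_)
    rw [PMF.pure_bind, queryOracle_eq]
    refine Eq.trans (congrArg (PMF.bind _) (funext fun r => ?_))
      (Prog.bind_run _ _ _ _ (PMF.pure ∘ verdict c t l (E κ sk)))
    rw [query_keyedRep, PMF.pure_map, Function.comp, verdict]
    by_cases hr : IsBet t l (r.1, r.2.2)
    · rw [if_pos hr, if_pos ⟨⟨hl, hr.2.1, hr.2.2.1, hr.2.2.2⟩, hr.1⟩]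
    · rw [if_neg hr, if_neg fun h => hr ⟨h.2, h.1.2.1, h.1.2.2.1, h.1.2.2.2⟩]
  · rw [if_neg hl]
    simp [InsertableFilter.GameResult.Legal, hl]

/-- The Always-Bet test is the chance to win the Bet-or-Pass test by always betting. -/
theorem abTest_eq (n t : ℕ) (A₁ A₂ : Prog) :
    (keyStoringNY E (truncationBloom c)).abTest κ n t A₁ A₂ true =
      (keyStoringNY E (truncationBloom c)).bpTest κ n t A₁ (.pair .tt A₂) .win := by
  classical
  rw [bpTest_eq]
  simp only [InsertableFilter.abTest, InsertableFilter.adaptiveGame, PMF.monad_bind_eq_bind,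
    PMF.monad_pure_eq_pure, PMF.bind_bind, PMF.pure_bind]
  rw [PMF.bind_apply, PMF.bind_apply]
  refine tsum_congr fun a => congrArg _ ?_
  set l := Data.toElems κ a.1
  by_cases hl : l.length = n
  · rw [if_pos hl, betTest, PMF.bind_map, build_eq, PMF.bind_bind, PMF.bind_apply, PMF.bind_apply]
    refine tsum_congr fun sk => congrArg _ ?_
    rw [PMF.pure_bind, queryOracle_eq]
    refine (DFunLike.congr_fun (Eq.trans (congrArg (PMF.bind _) (funext fun r => ?_))
      (Prog.bind_run _ _ _ _ fun r => PMF.pure (decide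
        (BetResult.win = verdict c t l (E κ sk) (.cons (.cons .nil .nil) r.1, r.2))))) true).trans ?_
    · rw [query_keyedRep, verdict]
      by_cases hr : IsBet t l (.cons (.cons .nil .nil) r.1, r.2.2)
      · have hr' := hr.2
        simp only [Data.snd_cons] at hr'
        rw [if_pos hr, if_pos ⟨hl, hr'.1, hr'.2.1, hr'.2.2⟩]
        simp only [Data.snd_cons]
        by_cases hp : isPositive c (E κ sk) l (Data.toBits κ r.1) = true <;> simp [hp]
      · rw [if_neg hr, if_neg fun h => hr ⟨rfl, h.2.1, h.2.2.1, h.2.2.2⟩]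
        simp
    · rw [Function.comp, view, Prog.sem, Prog.tt]
      simp only [Prog.sem, PMF.pure_bind, PMF.map_bind, PMF.pure_map]
      rw [PMF.bind_apply, PMF.bind_apply]
      refine tsum_congr fun r => congrArg _ ?_
      rw [PMF.pure_apply, PMF.pure_apply]
      simp
  · rw [if_neg hl]
    simp [InsertableFilter.GameResult.Legal, hl]

end tests

end

end

section

noncomputable section

open scoped ENNReal

namespace Prog

theorem RunsWithin.mono {p : Prog} {Ans : Set Data} {x : Data} {T T' : ℕ}
    (h : p.RunsWithin Ans x T) (hT : T ≤ T') : p.RunsWithin Ans x T' :=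
  fun σ O hO s r hr => (h σ O hO s r hr).trans hT

theorem LoopFree.runsWithin {p : Prog} (hp : p.LoopFree) (Ans : Set Data) (x : Data) :
    p.RunsWithin Ans x (2 * p.size) := by
  intro σ O _ s r hr
  have := hp.steps_le O x 0 s r hr
  omega

theorem RunsWithin.pair_tt {p : Prog} {Ans : Set Data} {x : Data} {T : ℕ}
    (h : p.RunsWithin Ans x T) : (Prog.pair tt p).RunsWithin Ans x (T + 8) := by
  intro σ O hO s r hr
  change r ∈ PMF.support ((Prog.pair tt p).eval O x (0, s)) at hr
  simp only [tt, eval_pair', eval_nil', PMF.pure_bind, PMF.mem_support_bind_iff,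
    PMF.mem_support_pure_iff] at hr
  obtain ⟨r', hr', rfl⟩ := hr
  obtain ⟨k, hk, hk'⟩ := mem_support_eval_shift O p _ _ _ _ hr'
  have := h σ O hO s _ (hk' 0)
  simp only [size, tt] at this ⊢
  omega

theorem gameBound_mono {κ n t t' T T' : ℕ} (ht : t ≤ t') (hT : T ≤ T') :
    gameBound κ n t T ≤ gameBound κ n t' T' := by
  unfold gameBound
  gcongr

/-- `gameBound` as a polynomial. -/
def gamePolynomial (n : ℕ) (Pt PT : Polynomial ℕ) : Polynomial ℕ :=
  (140 * .X + 140) * Polynomial.C n + (60 * .X + 60) * Pt + 300 +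
    ((30 * .X + 22) * Polynomial.C n + 60) * PT

theorem gamePolynomial_eval (n : ℕ) (Pt PT : Polynomial ℕ) (κ : ℕ) :
    (gamePolynomial n Pt PT).eval κ = gameBound κ n (Pt.eval κ) (PT.eval κ) := by
  simp only [gamePolynomial, gameBound, Polynomial.eval_add, Polynomial.eval_mul,
    Polynomial.eval_X, Polynomial.eval_C, Polynomial.eval_ofNat]

end Prog

theorem eventually_polynomial_le_two_pow (P : Polynomial ℕ) :
    ∀ᶠ κ : ℕ in Filter.atTop, P.eval κ ≤ 2 ^ κ := by
  have h : Filter.Tendsto (fun κ : ℕ => ((P.eval κ : ℕ) : ℝ) / 2 ^ κ) Filter.atTop (nhds 0) := by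
    induction P using Polynomial.induction_on' with
    | add p q hp hq =>
      simpa only [Polynomial.eval_add, Nat.cast_add, add_div, add_zero] using hp.add hq
    | monomial k a =>
      have := (tendsto_pow_const_div_const_pow_of_one_lt k (one_lt_two (α := ℝ))).const_mul (a : ℝ)
      simpa only [Polynomial.eval_monomial, Nat.cast_mul, Nat.cast_pow, mul_div_assoc,
        mul_zero] using this
  filter_upwards [h.eventually_lt_const one_pos] with κ hκ
  rw [div_lt_one (by positivity)] at hκ
  exact_mod_cast hκ.le

theorem Negligible.tendsto_zero {ν : ℕ → ℝ} (h : Negligible ν) :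
    Filter.Tendsto ν Filter.atTop (nhds 0) := by
  simpa using h 0

section resilience

variable {E : KeyedPerm} {n c : ℕ} {ε : ℝ}

/-- For every polynomial-time player, the chance to win an obligatory bet exceeds `ε` by a
negligible amount at most, and the expected profit is negligible. -/
theorem exists_negligible_betTest (hE : E.IsPRP) (hε₀ : 0 < ε) (hε₁ : ε < 1)
    (hc : 2 * (n : ℝ) ≤ ε * 2 ^ c) {t : ℕ → ℕ} {Pt P : Polynomial ℕ} (ht : ∀ κ, t κ ≤ Pt.eval κ)
    {A : ℕ → Prog} (hA : ∀ κ, ∀ l : List (Univ κ), l.Nodup → l.length = n →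
      (A κ).RunsWithin (Set.range Data.ofBool) (.cons (.unary κ) (.ofElems l)) (P.eval κ)) :
    ∃ ν : ℕ → ℝ, Negligible ν ∧ ∀ κ, 0 ≤ ν κ ∧ ∀ l : List (Univ κ), l.Nodup → l.length = n →
      (betTest ((PMF.uniformOfFintype (Univ κ)).map (E κ)) c (t κ) l (A κ) .win).toReal
        ≤ ε + ν κ ∧
      expectedProfit ε (betTest ((PMF.uniformOfFintype (Univ κ)).map (E κ)) c (t κ) l (A κ))
        ≤ ν κ := by
  classical
  obtain ⟨ν, hν, hadv⟩ := hE.exists_negligible (Prog.gamePolynomial n Pt P)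
  have h₁ : 0 < 1 - ε := by linarith
  have hK : 1 ≤ 1 / ε + 1 / (1 - ε) := by
    have : 1 ≤ 1 / ε := by rw [le_div_iff₀ hε₀]; linarith
    have : 0 ≤ 1 / (1 - ε) := by positivity
    linarith
  refine ⟨fun κ => if c ≤ κ ∧ 2 * (n + t κ) ≤ 2 ^ κ then (1 / ε + 1 / (1 - ε)) * |ν κ| else 1 / ε,
    ?_, fun κ => ?_⟩
  · have hν' : Negligible fun κ => (1 / ε + 1 / (1 - ε)) * |ν κ| :=
      (hν.trans_abs_le fun κ => (abs_abs _).le).const_mul _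
    refine hν'.congr' ?_
    filter_upwards [Filter.eventually_ge_atTop c,
      eventually_polynomial_le_two_pow (2 * (Polynomial.C n + Pt))] with κ h₂ h₃
    simp only [Polynomial.eval_mul, Polynomial.eval_add, Polynomial.eval_C,
      Polynomial.eval_ofNat] at h₃
    rw [if_pos ⟨h₂, (Nat.mul_le_mul_left _ (Nat.add_le_add_left (ht κ) _)).trans h₃⟩]
  · simp only
    split
    case isFalse h =>
      refine ⟨by positivity, fun l _ _ => ⟨?_, expectedProfit_le hε₀ hε₁ _⟩⟩
      have := ((betTest ((PMF.uniformOfFintype (Univ κ)).map (E κ)) c (t κ) l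
        (A κ)).toReal_apply_mem_Icc .win).2
      have : 1 ≤ 1 / ε := by rw [le_div_iff₀ hε₀]; linarith
      linarith
    case isTrue h =>
      have hν₀ := abs_nonneg (ν κ)
      refine ⟨by positivity, fun l hl hln => ?_⟩
      obtain ⟨p, hp, hw, hlo⟩ := exists_ideal_game (t := t κ) (ν := |ν κ|) E h.1 (A κ) l hε₀.le
        (by rwa [hln]) (by rw [hln]; exact h.2) (hA κ l hl hln) fun D hD =>
          (hadv κ D (hD.mono (by
            rw [Prog.gamePolynomial_eval, hln]
            exact Prog.gameBound_mono (ht κ) le_rfl))).trans (le_abs_self _)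
      refine ⟨?_, expectedProfit_le_of_close hε₀ hε₁ p _ hp hw hlo⟩
      have h₂ := win_add_lose_le p
      have h₃ := (abs_le.1 hw).2
      nlinarith

theorem bpResilient (hE : E.IsPRP) (hε₀ : 0 < ε) (hε₁ : ε < 1) (hc : 2 * (n : ℝ) ≤ ε * 2 ^ c)
    {t : ℕ → ℕ} {Pt : Polynomial ℕ} (ht : ∀ κ, t κ ≤ Pt.eval κ) :
    (keyStoringNY E (truncationBloom c)).BPResilient n t ε := by
  rintro A₁ A₂ ⟨P, hP⟩
  obtain ⟨ν, hν, h⟩ := exists_negligible_betTest hE hε₀ hε₁ hc ht fun κ => (hP κ).2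
  refine ⟨ν, hν, fun κ => ?_⟩
  rw [bpTest_eq]
  refine expectedProfit_bind_le hε₁ _ _ (h κ).1 fun a => ?_
  split
  · exact ((h κ).2 _ (List.nodup_dedup _) ‹_›).2
  · rw [expectedProfit_eq]
    simpa using (h κ).1

theorem abResilient (hE : E.IsPRP) (hε₀ : 0 < ε) (hε₁ : ε < 1) (hc : 2 * (n : ℝ) ≤ ε * 2 ^ c)
    {t : ℕ → ℕ} {Pt : Polynomial ℕ} (ht : ∀ κ, t κ ≤ Pt.eval κ) :
    (keyStoringNY E (truncationBloom c)).ABResilient n t ε := by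
  rintro A₁ A₂ ⟨P, hP⟩
  obtain ⟨ν, hν, h⟩ := exists_negligible_betTest (P := P + 8) (A := fun κ => .pair .tt (A₂ κ))
    hE hε₀ hε₁ hc ht fun κ l hl hln => by
      simpa using ((hP κ).2 l hl hln).pair_tt
  refine ⟨ν, hν, fun κ => ?_⟩
  rw [abTest_eq, bpTest_eq]
  have h₀ := (h κ).1
  refine PMF.bind_apply_le _ _ _ (by positivity) fun a => ?_
  split
  · exact ((h κ).2 _ (List.nodup_dedup _) ‹_›).1
  · simp
    positivity

end resilience

section soundness

variable {E : KeyedPerm} {n : ℕ} {ε : ℝ}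

/-- The player that bets on `x` without making queries. -/
theorem betTest_const {κ : ℕ} (Pi : PMF (Equiv.Perm (Univ κ))) (c : ℕ) (l : List (Univ κ))
    {x : Univ κ} (hx : x ∉ l) :
    betTest Pi c 0 l (Prog.const (.cons (.ofBool true) (.ofBits x))) .win =
      (Pi.bind fun π => PMF.pure (isPositive c π l x)) true := by
  rw [betTest, PMF.bind_apply, PMF.bind_apply]
  refine tsum_congr fun π => congrArg _ ?_
  rw [view, (Prog.const_plain _).sem_eq, PMF.pure_map, Prog.const_fn, verdict]
  have h : IsBet 0 l (Data.cons (.ofBool true) (.ofBits x), []) := by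
    simp [IsBet, hx]
  rw [if_pos h]
  simp only [Data.snd_cons, Data.toBits_ofBits]
  by_cases hp : isPositive c π l x = true <;> simp [hp]

theorem build_bind_query {κ : ℕ} (c : ℕ) (l : List (Univ κ)) (x : Univ κ) :
    ((keyStoringNY E (truncationBloom c)).build κ l.toFinset).bind
      (fun M => (keyStoringNY E (truncationBloom c)).query κ M x) =
    ((PMF.uniformOfFintype (Univ κ)).map (E κ)).bind fun π => PMF.pure (isPositive c π l x) := by
  rw [build_eq, PMF.bind_bind, PMF.bind_map]
  refine congrArg (PMF.bind _) (funext fun sk => ?_)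
  rw [PMF.pure_bind, query_keyedRep]
  rfl

/-- If the number `c` of bits is large enough, false positives have probability at most `ε` for
every security parameter. -/
theorem eventually_sound (hE : E.IsPRP) (hε₀ : 0 < ε) :
    ∀ᶠ c : ℕ in Filter.atTop, ∀ κ (S : Finset (Univ κ)), S.card = n → ∀ x ∉ S,
      (((keyStoringNY E (truncationBloom c)).build κ S).bind
        (fun M => (keyStoringNY E (truncationBloom c)).query κ M x) true).toReal ≤ ε := by
  obtain ⟨ν, hν, hadv⟩ := hE.exists_negligible (Prog.gamePolynomial n 0 (8 * .X + 20))
  obtain ⟨κ₀, hκ₀⟩ := Filter.eventually_atTop.1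
    (hν.tendsto_zero.eventually_le_const (half_pos hε₀))
  obtain ⟨κ₁, hκ₁⟩ := Filter.eventually_atTop.1
    (eventually_polynomial_le_two_pow (2 * Polynomial.C n))
  have hlarge : ∀ᶠ c : ℕ in Filter.atTop, 2 * (n : ℝ) ≤ ε / 2 * 2 ^ c :=
    ((tendsto_pow_atTop_atTop_of_one_lt (one_lt_two (α := ℝ))).const_mul_atTop
      (half_pos hε₀)).eventually_ge_atTop _
  filter_upwards [Filter.eventually_ge_atTop κ₀, Filter.eventually_ge_atTop κ₁, hlarge]
    with c h₀ h₁ hc κ S hS x hx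
  obtain ⟨l, hl, rfl⟩ : ∃ l : List (Univ κ), l.Nodup ∧ l.toFinset = S :=
    ⟨S.toList, S.nodup_toList, S.toList_toFinset⟩
  rw [List.toFinset_card_of_nodup hl] at hS
  rw [List.mem_toFinset] at hx
  rw [build_bind_query]
  rcases le_or_gt c κ with hcκ | hcκ
  · rw [← betTest_const _ c l hx]
    have hsize := Prog.const_ofBits_size x
    have hA := ((Prog.const_plain (.cons (.ofBool true) (.ofBits x))).loopFree.runsWithin
      (Set.range Data.ofBool) (.cons (.unary κ) (.ofElems l))).mono (T' := 8 * κ + 20) (by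
        simp only [Prog.const, Data.ofBool, Prog.size]
        omega)
    have h2 := hκ₁ κ (h₁.trans hcκ)
    simp only [Polynomial.eval_mul, Polynomial.eval_C, Polynomial.eval_ofNat] at h2
    obtain ⟨p, hp, hw, -⟩ := exists_ideal_game (t := 0) (ν := ν κ) E hcκ _ l (half_pos hε₀).le
      (by rwa [hS]) (by rw [hS]; exact h2) hA fun D hD => hadv κ D (hD.mono (by
        rw [Prog.gamePolynomial_eval, hS]
        exact Prog.gameBound_mono (Nat.zero_le _) (by simp)))
    have h₂ := win_add_lose_le p
    have h₃ := (abs_le.1 hw).2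
    have h₄ := hκ₀ κ (h₀.trans hcκ)
    nlinarith
  · refine PMF.bind_apply_le _ _ _ hε₀.le fun π => ?_
    have : isPositive c π l x = false := by
      rw [Bool.eq_false_iff, isPositive]
      simp only [ne_eq, List.any_eq_true, decide_eq_true_eq, not_exists, not_and]
      intro a ha h
      rw [Data.idx_ofBits_inj hcκ.le, π.injective.eq_iff] at h
      exact hx (h ▸ ha)
    rw [this]
    simp [hε₀.le]

end soundness

end

end

noncomputable section

namespace Prog

/-! ### Programs without oracles -/

/-- On input `x`, the program makes at most `T` steps and its output has distribution `μ`,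
whatever the counter shows in the beginning. -/
def Yields (p : Prog) (x : Data) (T : ℕ) (μ : PMF Data) : Prop :=
  (p.sem noOracle x ()).map Prod.fst = μ ∧
    ∀ n, ∀ r ∈ (p.eval noOracle x (n, ())).support, r.2.1 ≤ n + T

theorem Yields.computes {p : Prog} {x : Data} {T : ℕ} {μ : PMF Data} (h : p.Yields x T μ) :
    p.Computes x T μ := by
  constructor
  · rw [runPlain, PMF.map_comp, ← h.1]
    exact map_run noOracle p x () Prod.fst
  · intro r hr
    rw [runPlain, PMF.mem_support_map_iff] at hr
    obtain ⟨r', hr', rfl⟩ := hr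
    simpa using h.2 0 r' hr'

theorem Computes.yields {p : Prog} {x : Data} {T : ℕ} {μ : PMF Data} (h : p.Computes x T μ) :
    p.Yields x T μ := by
  constructor
  · rw [← h.1, runPlain, PMF.map_comp]
    exact (map_run noOracle p x () Prod.fst).symm
  · intro n r hr
    obtain ⟨k, hk, hk'⟩ := mem_support_eval_shift _ _ _ _ _ _ hr
    have := h.2 (r.1, 0 + k) (by
      rw [runPlain, PMF.mem_support_map_iff]
      exact ⟨_, hk' 0, rfl⟩)
    simp only at this
    omega

theorem Yields.mono {p : Prog} {x : Data} {T T' : ℕ} {μ : PMF Data} (h : p.Yields x T μ)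
    (hT : T ≤ T') : p.Yields x T' μ :=
  ⟨h.1, fun n r hr => (h.2 n r hr).trans (Nat.add_le_add_left hT _)⟩

theorem Plain.yields {p : Prog} (hp : p.Plain) (x : Data) :
    p.Yields x p.size (PMF.pure (p.fn x)) :=
  ⟨by rw [hp.sem_eq, PMF.pure_map], fun n r hr => hp.loopFree.steps_le _ _ _ _ r hr⟩

theorem Yields.seq {ι : Type} {p q : Prog} {x : Data} {T T' : ℕ} {μ : PMF ι} {f : ι → Data}
    {ν : ι → PMF Data} (hp : p.Yields x T (μ.map f)) (hq : ∀ i, q.Yields (f i) T' (ν i)) :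
    (Prog.seq p q).Yields x (T + T' + 1) (μ.bind ν) := by
  constructor
  · have h : ν = (fun y => (q.sem noOracle y ()).map Prod.fst) ∘ f := funext fun i => (hq i).1.symm
    rw [h, ← PMF.bind_map, ← hp.1, PMF.bind_map, sem, PMF.map_bind]
    rfl
  · intro n r hr
    rw [eval_seq, PMF.mem_support_bind_iff] at hr
    obtain ⟨⟨a, n₁, u⟩, ha, hr⟩ := hr
    have h₁ := hp.2 _ _ ha
    have ha' : a ∈ (μ.map f).support := by
      rw [← hp.1, PMF.mem_support_map_iff]
      exact ⟨_, mem_support_sem ha, rfl⟩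
    rw [PMF.mem_support_map_iff] at ha'
    obtain ⟨i, _, rfl⟩ := ha'
    have h₂ := (hq i).2 _ _ hr
    simp only at h₁ h₂
    omega

theorem Yields.seq_pure {p q : Prog} {x y : Data} {T T' : ℕ} {ν : PMF Data}
    (hp : p.Yields x T (PMF.pure y)) (hq : q.Yields y T' ν) :
    (Prog.seq p q).Yields x (T + T' + 1) ν := by
  have := Yields.seq (ι := Unit) (μ := PMF.pure ()) (f := fun _ => y) (ν := fun _ => ν)
    (by rwa [PMF.pure_map]) fun _ => hq
  rwa [PMF.pure_bind] at this

theorem Yields.pair {ι : Type} {p q : Prog} {x b : Data} {T T' : ℕ} {μ : PMF ι} {f : ι → Data}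
    (hp : p.Yields x T (μ.map f)) (hq : q.Yields x T' (PMF.pure b)) :
    (Prog.pair p q).Yields x (T + T' + 1) (μ.map fun i => .cons (f i) b) := by
  constructor
  · have h : (μ.map fun i => Data.cons (f i) b) =
        (μ.map f).bind fun a => (PMF.pure b).map fun b' => Data.cons a b' := by
      simp only [PMF.pure_map, PMF.bind_map]
      rfl
    rw [h, ← hp.1, ← hq.1, PMF.bind_map, sem, PMF.map_bind]
    refine congrArg (PMF.bind _) (funext fun r => ?_)
    rw [PMF.map_bind, Function.comp, PMF.map_comp]
    simp only [PMF.pure_map]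
    rfl
  · intro n r hr
    rw [eval_pair, PMF.mem_support_bind_iff] at hr
    obtain ⟨⟨a, n₁, u⟩, ha, hr⟩ := hr
    rw [PMF.mem_support_bind_iff] at hr
    obtain ⟨⟨a', n₂, u'⟩, ha', hr⟩ := hr
    rw [PMF.mem_support_pure_iff] at hr
    subst hr
    have h₁ := hp.2 _ _ ha
    have h₂ := hq.2 _ _ ha'
    simp only at h₁ h₂ ⊢
    omega

theorem Yields.pair_pure {p q : Prog} {x a b : Data} {T T' : ℕ}
    (hp : p.Yields x T (PMF.pure a)) (hq : q.Yields x T' (PMF.pure b)) :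
    (Prog.pair p q).Yields x (T + T' + 1) (PMF.pure (.cons a b)) := by
  have := Yields.pair (ι := Unit) (μ := PMF.pure ()) (f := fun _ => a)
    (by rwa [PMF.pure_map]) hq
  rwa [PMF.pure_map] at this

theorem Yields.fold {α β : Type} {p : Prog} {T : ℕ} (enc : α → Data) (enc' : β → Data)
    (step : β → α → β)
    (hp : ∀ a b, p.Yields (.cons (enc a) (enc' b)) T (PMF.pure (enc' (step b a)))) (l : List α)
    (b : β) : (Prog.fold p).Yields (.cons (.ofList (l.map enc)) (enc' b)) (l.length * T + 1)
      (PMF.pure (enc' (l.foldl step b))) := by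
  constructor
  · rw [sem, Data.fst_cons, Data.snd_cons, Data.toList_ofList]
    induction l generalizing b with
    | nil => exact PMF.pure_map _ _
    | cons a l ih =>
      rw [List.map_cons, loop, PMF.map_bind, List.foldl_cons, ← ih,
        ← PMF.pure_bind (enc' (step b a)) fun d =>
          (loop (p.sem noOracle) (l.map enc) d ()).map Prod.fst, ← (hp a b).1, PMF.bind_map]
      rfl
  · intro n r hr
    rw [eval_fold, Data.fst_cons, Data.snd_cons, Data.toList_ofList] at hr
    suffices H : ∀ n, r ∈ (loop (p.eval noOracle) (l.map enc) (enc' b) (n, ())).support →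
        r.2.1 ≤ n + l.length * T by
      have := H _ hr
      omega
    clear hr
    induction l generalizing b with
    | nil =>
      intro n hr
      rw [List.map_nil, loop, PMF.mem_support_pure_iff] at hr
      subst hr
      simp
    | cons a l ih =>
      intro n hr
      rw [List.map_cons, loop, PMF.mem_support_bind_iff] at hr
      obtain ⟨⟨d, n₁, u⟩, hd, hr⟩ := hr
      have h₁ := (hp a b).2 _ _ hd
      have hd' : d ∈ (PMF.pure (enc' (step b a))).support := by
        rw [← (hp a b).1, PMF.mem_support_map_iff]
        exact ⟨_, mem_support_sem hd, rfl⟩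
      rw [PMF.mem_support_pure_iff] at hd'
      subst hd'
      have h₂ := ih _ _ hr
      rw [List.length_cons, add_mul, one_mul]
      simp only at h₁
      omega

end Prog

theorem PMF.uniformOfFintype_bind_map_equiv {α β γ : Type} [Fintype α] [Nonempty α] [Fintype β]
    [Nonempty β] [Fintype γ] [Nonempty γ] (e : α × β ≃ γ) :
    ((PMF.uniformOfFintype α).bind fun a => (PMF.uniformOfFintype β).map fun b => e (a, b)) =
      PMF.uniformOfFintype γ := by
  classical
  ext c
  obtain ⟨⟨a, b⟩, rfl⟩ := e.surjective c
  simp only [PMF.bind_apply, PMF.map_apply, PMF.uniformOfFintype_apply, e.injective.eq_iff,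
    Prod.mk.injEq, tsum_fintype]
  rw [Finset.sum_eq_single a, Finset.sum_eq_single b]
  · rw [if_pos ⟨rfl, rfl⟩, ← Fintype.card_congr e, Fintype.card_prod, Nat.cast_mul,
      ENNReal.mul_inv (Or.inr (ENNReal.natCast_ne_top _)) (Or.inl (ENNReal.natCast_ne_top _))]
  · intro b' _ hb'
    rw [if_neg fun h => hb' h.2.symm]
  · simp
  · intro a' _ ha'
    rw [Finset.sum_eq_zero, mul_zero]
    intro b' _
    rw [if_neg fun h => ha' h.1.symm]
  · simp

namespace Prog

/-- A uniformly random string of the length of the list that is given. -/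
def randomP : Prog := .fold (.pair .coin .snd)

theorem randomP_loop (k : ℕ) : ∀ l : List Data,
    (loop ((Prog.pair .coin .snd).sem noOracle) (List.replicate k .nil) (.ofList l) ()).map Prod.fst =
      (PMF.uniformOfFintype (Fin k → Bool)).map fun v =>
        Data.ofList ((List.ofFn v).map Data.ofBool ++ l) := by
  induction k with
  | zero =>
    intro l
    simp only [List.replicate_zero, loop, PMF.pure_map, List.ofFn_zero, List.map_nil,
      List.nil_append]
    exact (PMF.map_const _ _).symm
  | succ k ih =>
    intro l
    rw [List.replicate_succ, loop, PMF.map_bind, ← PMF.uniformOfFintype_bind_map_equiv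
      (Fin.snocEquiv fun _ : Fin (k + 1) => Bool), PMF.map_bind]
    have h : (Prog.pair .coin .snd).sem noOracle (.cons .nil (.ofList l)) () =
        (PMF.uniformOfFintype Bool).bind fun b =>
          PMF.pure (Data.ofList (Data.ofBool b :: l), ()) := by
      simp only [sem, PMF.pure_bind, PMF.bind_bind, Data.snd_cons, Data.ofList]
    rw [h, PMF.bind_bind]
    refine congrArg (PMF.bind _) (funext fun b => ?_)
    rw [PMF.pure_bind, ih, PMF.map_comp]
    refine congrArg (PMF.map · _) (funext fun v => ?_)
    rw [Function.comp, List.ofFn_succ']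
    simp [Fin.snocEquiv]

theorem randomP_yields (κ : ℕ) : randomP.Yields (.cons (.unary κ) .nil) (3 * κ + 1)
    ((PMF.uniformOfFintype (Univ κ)).map Data.ofBits) := by
  constructor
  · rw [randomP, sem, Data.fst_cons, Data.snd_cons, Data.unary, Data.toList_ofList]
    refine (randomP_loop κ []).trans ?_
    simp only [List.append_nil]
    rfl
  · intro n r hr
    rw [randomP, eval_fold, Data.fst_cons, Data.snd_cons, Data.unary, Data.toList_ofList] at hr
    suffices H : ∀ k n d, r ∈ (loop ((Prog.pair .coin .snd).eval noOracle)
        (List.replicate k Data.nil) d (n, ())).support → r.2.1 ≤ n + 3 * k by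
      have := H _ _ _ hr
      omega
    intro k
    induction k with
    | zero =>
      intro n d hr
      rw [List.replicate_zero, loop, PMF.mem_support_pure_iff] at hr
      subst hr
      simp
    | succ k ih =>
      intro n d hr
      rw [List.replicate_succ, loop, PMF.mem_support_bind_iff] at hr
      obtain ⟨⟨d', n₁, u⟩, hd, hr⟩ := hr
      have h₁ := LoopFree.steps_le noOracle (p := .pair .coin .snd) ⟨trivial, trivial⟩ _ _ _ _ hd
      have h₂ := ih _ _ hr
      simp only [size] at h₁
      omega

/-! ### Access to arrays -/

/-- Branching on the number that is given by the first `c` bits of the output of `y`. -/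
def selP : ℕ → Prog → (ℕ → Prog) → Prog
  | 0, _, f => f 0
  | c + 1, y, f => .cond (.seq y .fst) (selP c (.seq y .snd) fun j => f (2 * j + 1))
      (selP c (.seq y .snd) fun j => f (2 * j))

theorem selP_plain (c : ℕ) : ∀ {y : Prog} {f : ℕ → Prog}, y.Plain → (∀ j, (f j).Plain) →
    (selP c y f).Plain := by
  induction c with
  | zero => intro y f _ hf; exact hf 0
  | succ c ih =>
    intro y f hy hf
    exact ⟨⟨hy, trivial⟩, ih ⟨hy, trivial⟩ fun j => hf _, ih ⟨hy, trivial⟩ fun j => hf _⟩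

theorem selP_fn (c : ℕ) : ∀ (y : Prog) (f : ℕ → Prog) (z : Data),
    (selP c y f).fn z = (f ((y.fn z).idx c)).fn z := by
  induction c with
  | zero => intro y f z; rfl
  | succ c ih =>
    intro y f z
    simp only [selP, fn, ih, Data.idx]
    by_cases h : (y.fn z).fst.isTrue = true
    · simp [h]
    · simp [h]

theorem dropP_fn_ofList (j : ℕ) : ∀ l : List Data, (dropP j).fn (.ofList l) = .ofList (l.drop j) := by
  induction j with
  | zero => intro l; rfl
  | succ j ih =>
    rintro (_ | ⟨a, l⟩)
    · exact dropP_nil (j + 1)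
    · exact ih l

theorem dropP_fn_ofBits {m : ℕ} (v : Fin m → Bool) (j : Fin m) :
    ((dropP j).fn (.ofBits v)).fst = Data.ofBool (v j) := by
  rw [Data.ofBits, dropP_fn_ofList, List.drop_eq_getElem_cons (by simp)]
  simp [Data.ofList]

/-- Set the `j`-th bit of an array. -/
def setP : ℕ → Prog
  | 0 => .pair tt .snd
  | j + 1 => .pair .fst (.seq .snd (setP j))

theorem setP_plain (j : ℕ) : (setP j).Plain := by
  induction j with
  | zero => simp [setP, tt, Plain]
  | succ j ih => simp [setP, Plain, ih]

theorem setP_fn_ofList (j : ℕ) : ∀ l : List Bool, j < l.length →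
    (setP j).fn (.ofList (l.map Data.ofBool)) = .ofList ((l.set j true).map Data.ofBool) := by
  induction j with
  | zero =>
    rintro (_ | ⟨a, l⟩) h
    · simp at h
    · rfl
  | succ j ih =>
    rintro (_ | ⟨a, l⟩) h
    · simp at h
    · have := ih l (by simpa using h)
      simp only [List.map_cons, Data.ofList, setP, fn, Data.fst_cons, Data.snd_cons, this,
        List.set_cons_succ]

theorem setP_fn_ofBits {m : ℕ} (v : Fin m → Bool) (j : Fin m) :
    (setP j).fn (.ofBits v) = .ofBits fun i => v i || decide (j = i) := by
  rw [Data.ofBits, setP_fn_ofList j _ (by simp), Data.ofBits]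
  congr 2
  refine List.ext_getElem (by simp) fun i h₁ h₂ => ?_
  rw [List.getElem_set]
  by_cases h : (j : ℕ) = i
  · simp [h, Fin.ext_iff]
  · simp [h, Fin.ext_iff]

end Prog

end

noncomputable section

theorem Polynomial.eval_mono_nat (P : Polynomial ℕ) {a b : ℕ} (h : a ≤ b) :
    P.eval a ≤ P.eval b := by
  induction P using Polynomial.induction_on' with
  | add p q hp hq =>
    rw [Polynomial.eval_add, Polynomial.eval_add]
    exact Nat.add_le_add hp hq
  | monomial k c =>
    rw [Polynomial.eval_monomial, Polynomial.eval_monomial]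
    gcongr

namespace Prog

/-! ### The algorithms of the key-storing filter

A representation consists of a key and an array; `p` evaluates the permutation. -/

/-- From the security parameter, a representation and an element, compute the array and the image
of the element. -/
def prepareP (p : Prog) : Prog :=
  .pair (.seq .snd (.seq .fst .snd))
    (.seq (.pair .fst (.pair (.seq .snd (.seq .fst .fst)) (.seq .snd .snd))) p)

/-- The array cell at the index that a string determines. -/
def cellP (c : ℕ) : Prog := selP c .snd fun j => .seq .fst (.seq (dropP j) .fst)

/-- Set the array cell at the index that a string determines. -/
def markP (c : ℕ) : Prog := selP c .snd fun j => .seq .fst (setP j)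

def queryP (c : ℕ) (p : Prog) : Prog := .seq (prepareP p) (cellP c)

def insertP (c : ℕ) (p : Prog) : Prog :=
  .pair (.seq .snd (.seq .fst .fst)) (.seq (prepareP p) (markP c))

/-- Insertion of an element into a representation that is stored together with the security
parameter. -/
def insertStepP (c : ℕ) (p : Prog) : Prog :=
  .pair (.seq .snd .fst)
    (.seq (.pair (.seq .snd .fst) (.pair (.seq .snd .snd) .fst)) (insertP c p))

def buildP (c : ℕ) (p : Prog) : Prog :=
  .seq (.pair (.seq (.pair .fst .nil) randomP) .id)
    (.seq (.pair (.seq .snd .snd) (.pair (.seq .snd .fst)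
        (.pair .fst (const (.ofBits fun _ : Fin (2 ^ c) => false)))))
      (.seq (.fold (insertStepP c p)) .snd))

theorem cellP_plain (c : ℕ) : (cellP c).Plain :=
  selP_plain c trivial fun j => ⟨trivial, dropP_plain j, trivial⟩

theorem markP_plain (c : ℕ) : (markP c).Plain :=
  selP_plain c trivial fun j => ⟨trivial, setP_plain j⟩

/-- The program `p` evaluates `E` in time `P`. -/
def Evaluates (p : Prog) (E : KeyedPerm) (P : Polynomial ℕ) : Prop :=
  ∀ (κ : ℕ) (sk x : Univ κ),
    p.Computes (.cons (.unary κ) (.cons (.ofBits sk) (.ofBits x))) (P.eval κ)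
      (pure (.ofBits (E κ sk x)))

variable {E : KeyedPerm} {p : Prog} {P : Polynomial ℕ}

theorem prepareP_yields (hp : p.Evaluates E P) (c κ : ℕ)
    (M : (keyStoringNY E (truncationBloom c)).Rep κ) (x : Univ κ) :
    (prepareP p).Yields (.cons (.unary κ) (.cons ((keyStoringNY E (truncationBloom c)).encode κ M)
      (.ofBits x))) (P.eval κ + 30) (PMF.pure (.cons (.ofBits M.2) (.ofBits (E κ M.1 x)))) := by
  refine (Yields.pair_pure (Plain.yields (by simp [Plain]) _) (Yields.seq_pure
    (Plain.yields (by simp [Plain]) _) (hp κ M.1 x).yields)).mono ?_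
  simp only [size]
  omega

theorem queryP_yields (hp : p.Evaluates E P) (c κ : ℕ)
    (M : (keyStoringNY E (truncationBloom c)).Rep κ) (x : Univ κ) :
    (queryP c p).Yields (.cons (.unary κ) (.cons ((keyStoringNY E (truncationBloom c)).encode κ M)
      (.ofBits x))) (P.eval κ + (cellP c).size + 31)
      (((keyStoringNY E (truncationBloom c)).query κ M x).map Data.ofBool) := by
  have h : ((keyStoringNY E (truncationBloom c)).query κ M x).map Data.ofBool =
      PMF.pure ((cellP c).fn (.cons (.ofBits M.2) (.ofBits (E κ M.1 x)))) := by
    refine (PMF.pure_map _ _).trans (congrArg PMF.pure ?_)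
    rw [cellP, selP_fn]
    refine Eq.trans (congrArg Data.ofBool ?_)
      (dropP_fn_ofBits M.2 ((truncationBloom c).hash κ (0 : Fin 1) (E κ M.1 x))).symm
    exact Bool.eq_iff_iff.2 (decide_eq_true_iff.trans Fin.forall_fin_one)
  rw [h]
  refine (Yields.seq_pure (prepareP_yields hp c κ M x) ((cellP_plain c).yields _)).mono ?_
  omega

/-- Insertion is deterministic. -/
def insertRep (E : KeyedPerm) (c κ : ℕ) (M : (keyStoringNY E (truncationBloom c)).Rep κ)
    (x : Univ κ) : (keyStoringNY E (truncationBloom c)).Rep κ :=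
  (M.1, (truncationBloom c).add κ M.2 (E κ M.1 x))

theorem insertP_yields (hp : p.Evaluates E P) (c κ : ℕ)
    (M : (keyStoringNY E (truncationBloom c)).Rep κ) (x : Univ κ) :
    (insertP c p).Yields (.cons (.unary κ) (.cons ((keyStoringNY E (truncationBloom c)).encode κ M)
      (.ofBits x))) (P.eval κ + (markP c).size + 40)
      (PMF.pure ((keyStoringNY E (truncationBloom c)).encode κ (insertRep E c κ M x))) := by
  have h : (Data.ofBits (insertRep E c κ M x).2) =
      (markP c).fn (.cons (.ofBits M.2) (.ofBits (E κ M.1 x))) := by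
    rw [markP, selP_fn]
    refine Eq.trans (congrArg Data.ofBits (funext fun j => ?_))
      (setP_fn_ofBits M.2 ((truncationBloom c).hash κ (0 : Fin 1) (E κ M.1 x))).symm
    exact congrArg (M.2 j || ·) (decide_eq_decide.2 Fin.exists_fin_one)
  change Yields _ _ _ (PMF.pure (.cons (.ofBits M.1) (.ofBits (insertRep E c κ M x).2)))
  rw [h]
  refine (Yields.pair_pure (Plain.yields (by simp [Plain]) _) (Yields.seq_pure
    (prepareP_yields hp c κ M x) ((markP_plain c).yields _))).mono ?_
  simp only [size]
  omega

theorem insertStepP_yields (hp : p.Evaluates E P) (c κ : ℕ) (x : Univ κ)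
    (M : (keyStoringNY E (truncationBloom c)).Rep κ) :
    (insertStepP c p).Yields
      (.cons (.ofBits x) (.cons (.unary κ) ((keyStoringNY E (truncationBloom c)).encode κ M)))
      (P.eval κ + (markP c).size + 60)
      (PMF.pure (.cons (.unary κ)
        ((keyStoringNY E (truncationBloom c)).encode κ (insertRep E c κ M x)))) := by
  refine (Yields.pair_pure (Plain.yields (by simp [Plain]) _) (Yields.seq_pure
    (Plain.yields (by simp [Plain]) _) (insertP_yields hp c κ M x))).mono ?_
  simp only [size]
  omega

theorem array_image_eq_true (c : ℕ) {κ : ℕ} (π : Equiv.Perm (Univ κ)) (l : List (Univ κ))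
    (j : Fin (2 ^ c)) : (truncationBloom c).array κ (l.toFinset.image π) j = true ↔
      ∃ x ∈ l, ∃ i, (truncationBloom c).hash κ i (π x) = j := by
  simp [StandardBloom.array]

theorem add_eq_true_iff (c : ℕ) {κ : ℕ} (M : Fin (2 ^ c) → Bool) (y : Univ κ) (j : Fin (2 ^ c)) :
    (truncationBloom c).add κ M y j = true ↔
      M j = true ∨ ∃ i, (truncationBloom c).hash κ i y = j := by
  simp [StandardBloom.add]

theorem foldl_insertRep (c κ : ℕ) (l : List (Univ κ)) :
    ∀ M : (keyStoringNY E (truncationBloom c)).Rep κ,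
      (l.foldl (insertRep E c κ) M).1 = M.1 ∧ ∀ j, (l.foldl (insertRep E c κ) M).2 j =
        (M.2 j || (truncationBloom c).array κ (l.toFinset.image (E κ M.1)) j) := by
  induction l with
  | nil =>
    intro M
    simp [StandardBloom.array]
  | cons a l ih =>
    intro M
    rw [List.foldl_cons]
    refine ⟨(ih _).1, fun j => ((ih _).2 j).trans ?_⟩
    rw [Bool.eq_iff_iff, Bool.or_eq_true, Bool.or_eq_true]
    refine (or_congr (add_eq_true_iff c M.2 (E κ M.1 a) j)
      (array_image_eq_true c (E κ M.1) l j)).trans (Iff.trans ?_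
        (or_congr_right (array_image_eq_true c (E κ M.1) (a :: l) j).symm))
    rw [or_assoc, List.exists_mem_cons_iff]

theorem buildP_yields (hp : p.Evaluates E P) (c κ : ℕ) (l : List (Univ κ)) :
    (buildP c p).Yields (.cons (.unary κ) (.ofElems l))
      (3 * κ + l.length * (P.eval κ + (markP c).size + 60) +
        (const (.ofBits fun _ : Fin (2 ^ c) => false)).size + 40)
      (((keyStoringNY E (truncationBloom c)).build κ l.toFinset).map
        ((keyStoringNY E (truncationBloom c)).encode κ)) := by
  have h : ((keyStoringNY E (truncationBloom c)).build κ l.toFinset).map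
      ((keyStoringNY E (truncationBloom c)).encode κ) = (PMF.uniformOfFintype (Univ κ)).bind
        fun sk => PMF.pure ((keyStoringNY E (truncationBloom c)).encode κ (keyedRep E c sk l)) := by
    rw [build_eq, PMF.map_bind]
    simp only [PMF.pure_map]
  rw [h]
  have hrest (sk : Univ κ) := Yields.seq_pure (x := .cons (.ofBits sk) (.cons (.unary κ) (.ofElems l)))
    (Plain.yields (p := .pair (.seq .snd .snd) (.pair (.seq .snd .fst)
        (.pair .fst (const (.ofBits fun _ : Fin (2 ^ c) => false)))))
      ⟨⟨trivial, trivial⟩, ⟨trivial, trivial⟩, trivial, const_plain _⟩ _)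
    (Yields.seq_pure (p := .fold (insertStepP c p)) (q := .snd)
      (y := .cons (.unary κ) ((keyStoringNY E (truncationBloom c)).encode κ (keyedRep E c sk l)))
      (T := l.length * (P.eval κ + (markP c).size + 60) + 1) (by
        have := Yields.fold (p := insertStepP c p) Data.ofBits
          (fun M => .cons (.unary κ) ((keyStoringNY E (truncationBloom c)).encode κ M))
          (insertRep E c κ) (insertStepP_yields hp c κ) l (sk, fun _ => false)
        have hM := foldl_insertRep (E := E) c κ l (sk, fun _ => false)
        have hM' : l.foldl (insertRep E c κ) (sk, fun _ => false) = keyedRep E c sk l :=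
          Prod.ext hM.1 (funext fun j => (hM.2 j).trans (Bool.false_or _))
        rw [hM'] at this
        simp only [fn, const_fn, Data.fst_cons, Data.snd_cons]
        exact this) (Plain.yields (p := .snd) trivial _))
  refine (Yields.seq (Yields.pair (Yields.seq_pure
    (Plain.yields (p := .pair .fst .nil) ⟨trivial, trivial⟩ _) (randomP_yields κ))
      (Plain.yields (p := .id) trivial _)) hrest).mono ?_
  simp only [size]
  omega

end Prog

/-- The key-storing filter is efficient. -/
theorem keyStoringNY_efficient {E : KeyedPerm} {p : Prog} {P : Polynomial ℕ}
    (hp : p.Evaluates E P) (c : ℕ) : (keyStoringNY E (truncationBloom c)).Efficient := by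
  let K := (Prog.cellP c).size + (Prog.markP c).size +
    (Prog.const (.ofBits fun _ : Fin (2 ^ c) => false)).size + 100
  refine ⟨Prog.buildP c p, Prog.queryP c p, Prog.insertP c p,
    (.X + 1) * (P + Polynomial.C K) + 3 * .X, fun κ => ⟨fun l _ => ?_, fun M x => ?_, fun M x => ?_⟩⟩
  · refine ((Prog.buildP_yields hp c κ l).mono ?_).computes
    have h₁ := P.eval_mono_nat (Nat.le_add_right κ l.length)
    simp only [Polynomial.eval_add, Polynomial.eval_mul, Polynomial.eval_X, Polynomial.eval_C,
      Polynomial.eval_one, Polynomial.eval_ofNat]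
    have h₂ : l.length * (P.eval κ + (Prog.markP c).size + 60) ≤
        (κ + l.length) * (P.eval (κ + l.length) + K) := by
      refine Nat.mul_le_mul (Nat.le_add_left _ _) ?_
      omega
    rw [add_mul, one_mul]
    omega
  · refine ((Prog.queryP_yields hp c κ M x).mono ?_).computes
    simp only [Polynomial.eval_add, Polynomial.eval_mul, Polynomial.eval_X, Polynomial.eval_C,
      Polynomial.eval_one, Polynomial.eval_ofNat]
    rw [add_mul, one_mul]
    omega
  · have h : ((keyStoringNY E (truncationBloom c)).insert κ M x).map
        ((keyStoringNY E (truncationBloom c)).encode κ) =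
        PMF.pure ((keyStoringNY E (truncationBloom c)).encode κ (Prog.insertRep E c κ M x)) :=
      PMF.pure_map _ _
    rw [h]
    refine ((Prog.insertP_yields hp c κ M x).mono ?_).computes
    simp only [Polynomial.eval_add, Polynomial.eval_mul, Polynomial.eval_X, Polynomial.eval_C,
      Polynomial.eval_one, Polynomial.eval_ofNat]
    rw [add_mul, one_mul]
    omega

end

section

noncomputable section

open scoped ENNReal

section bloom

variable (E : KeyedPerm) (c : ℕ) {κ : ℕ}

theorem query_apply (M : (keyStoringNY E (truncationBloom c)).Rep κ) (x : Univ κ) :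
    (keyStoringNY E (truncationBloom c)).query κ M x =
      PMF.pure ((truncationBloom c).lookup κ M.2 (E κ M.1 x)) := rfl

theorem mem_support_insert {M M' : (keyStoringNY E (truncationBloom c)).Rep κ} {x : Univ κ}
    (h : M' ∈ ((keyStoringNY E (truncationBloom c)).insert κ M x).support) :
    M' = Prog.insertRep E c κ M x :=
  (PMF.mem_support_pure_iff _ _).1 h

theorem query_eq_one_iff (M : (keyStoringNY E (truncationBloom c)).Rep κ) (x : Univ κ) :
    (keyStoringNY E (truncationBloom c)).query κ M x true = 1 ↔
      ∀ i, M.2 ((truncationBloom c).hash κ i (E κ M.1 x)) = true := by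
  have h : (truncationBloom c).lookup κ M.2 (E κ M.1 x) = true ↔
      ∀ i, M.2 ((truncationBloom c).hash κ i (E κ M.1 x)) = true := decide_eq_true_iff
  rw [query_apply, PMF.pure_apply, ← h]
  by_cases h' : (truncationBloom c).lookup κ M.2 (E κ M.1 x) = true
  · simp [h']
  · simp [h']

theorem query_insertRep {M : (keyStoringNY E (truncationBloom c)).Rep κ} {x : Univ κ}
    (h : (keyStoringNY E (truncationBloom c)).query κ M x true = 1) (y : Univ κ) :
    (keyStoringNY E (truncationBloom c)).query κ (Prog.insertRep E c κ M y) x true = 1 := by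
  rw [query_eq_one_iff] at h ⊢
  exact fun i => (Bool.or_eq_true _ _).to_iff.2 (Or.inl (h i))

variable {E}

theorem isBloom {n : ℕ} {ε : ℝ} (hE : E.Efficient)
    (hs : ∀ κ (S : Finset (Univ κ)), S.card = n → ∀ x ∉ S,
      (((keyStoringNY E (truncationBloom c)).build κ S).bind
        (fun M => (keyStoringNY E (truncationBloom c)).query κ M x) true).toReal ≤ ε) :
    (keyStoringNY E (truncationBloom c)).IsBloom n ε where
  efficient := by
    obtain ⟨p, P, hp⟩ := hE
    exact keyStoringNY_efficient (p := p) (P := P) hp c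
  complete κ S _ x hx := by
    rw [← S.toList_toFinset, build_bind_query]
    have h (π : Equiv.Perm (Univ κ)) : isPositive c π S.toList x = true :=
      List.any_eq_true.2 ⟨x, Finset.mem_toList.2 hx, by simp⟩
    simp only [h, PMF.bind_const]
    exact PMF.pure_apply_self _
  sound := hs
  inserted κ M x M' hM' := by
    rw [mem_support_insert E c hM', query_eq_one_iff]
    exact fun i => (Bool.or_eq_true _ _).to_iff.2 (Or.inr (decide_eq_true ⟨i, rfl⟩))
  permanence κ M x h M' hM' := by
    induction hM' with
    | refl => exact h
    | tail _ h₂ ih =>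
      obtain ⟨y, hy⟩ := h₂
      rw [mem_support_insert E c hy]
      exact query_insertRep E c ih y
  monotone κ M x M' hM' y := by
    rw [mem_support_insert E c hM']
    by_cases h : (keyStoringNY E (truncationBloom c)).query κ M y true = 1
    · rw [query_insertRep E c h x]
      exact PMF.coe_le_one _ _
    · have h₀ : (keyStoringNY E (truncationBloom c)).query κ M y true = 0 := by
        rw [query_apply, PMF.pure_apply] at h ⊢
        simpa using h
      rw [h₀]
      exact bot_le

end bloom

/-! ### The attack on Filić correctness -/

theorem prob_uniform_eval {ι β : Type} [Fintype ι] [DecidableEq ι] [Fintype β] [DecidableEq β]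
    [Nonempty β] (i : ι) (j : β) :
    ((PMF.uniformOfFintype (ι → β)).map fun f => decide (f i = j)) true =
      (Fintype.card β : ℝ≥0∞)⁻¹ := by
  have h : ∀ j' : β, ((PMF.uniformOfFintype (ι → β)).map fun f => decide (f i = j')) true =
      ((PMF.uniformOfFintype (ι → β)).map fun f => decide (f i = j)) true := by
    intro j'
    simp only [PMF.map_decide_true, PMF.uniformOfFintype_apply, tsum_fintype]
    rw [← Equiv.sum_comp (Equiv.arrowCongr (Equiv.refl ι) (Equiv.swap j j'))]
    refine Finset.sum_congr rfl fun f _ => ?_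
    simp [Equiv.arrowCongr, Equiv.swap_apply_eq_iff]
  have hsum : ∑ j' : β, ((PMF.uniformOfFintype (ι → β)).map fun f => decide (f i = j')) true = 1 := by
    simp only [PMF.map_decide_true, tsum_fintype]
    rw [Finset.sum_comm]
    simp only [Finset.sum_ite_eq, Finset.mem_univ, if_true]
    rw [← tsum_fintype (L := .unconditional _)]
    exact PMF.tsum_coe _
  rw [Finset.sum_congr rfl fun j' _ => h j', Finset.sum_const, Finset.card_univ,
    nsmul_eq_mul] at hsum
  rw [mul_comm] at hsum
  exact ENNReal.eq_inv_of_mul_eq_one_left hsum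

namespace Prog

/-- The adversary asks for the representation and hands it on together with the element of its
set. -/
def revealP : Prog := .pair .fst (.pair (.call 2) (.seq .snd .fst))

end Prog

theorem toElems_zero (κ : ℕ) : Data.toElems κ (.cons .nil .nil) = [fun _ => false] := by
  simp only [Data.toElems, Data.toList, List.map_cons, List.map_nil, List.dedup_cons_of_notMem (List.not_mem_nil), List.dedup_nil]
  refine congrArg (· :: []) (funext fun i => ?_)
  simp [Data.toBits, Data.toList]

theorem tt_runPlain (x : Data) : Prog.tt.runPlain x = PMF.pure (.cons .nil .nil, 3) := by
  change PMF.map _ (Prog.tt.eval noOracle x (0, ())) = _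
  simp only [Prog.tt, Prog.eval_pair', Prog.eval_nil', PMF.pure_bind, PMF.pure_map]

/-- The experiment with the adversary that reveals the representation of the singleton of the zero
string at once. -/
theorem filicExperiment_reveal {κ : ℕ} (W : World κ) (rep : W.State → Data)
    (next : W.State → W.State) (hW : ∀ s, W.reveal s = PMF.pure (rep s, next s)) (D : Prog) :
    filicExperiment W .tt Prog.revealP D =
      (W.init {fun _ => false}).bind fun s =>
        (D.runPlain (.cons (.unary κ) (.cons (rep s) (.ofBits fun _ : Fin κ => false)))).map fun d =>
          ⟨d.1.isTrue, 10, d.2, ⟨next s, 0, 0, 1⟩⟩ := by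
  simp only [filicExperiment, PMF.monad_bind_eq_bind, PMF.monad_pure_eq_pure, tt_runPlain,
    PMF.pure_bind, toElems_zero]
  have h (s : W.State) : Prog.revealP.run W.oracle ⟨s, 0, 0, 0⟩
      (.cons (.unary κ) (.ofElems [fun _ : Fin κ => false])) =
      PMF.pure (.cons (.unary κ) (.cons (rep s) (.ofBits fun _ : Fin κ => false)), 7,
        ⟨next s, 0, 0, 1⟩) := by
    change Prog.revealP.eval W.oracle _ (0, _) = _
    have hO (i : ℕ) (q : Counted W.State) (d : Data) : W.oracle (i + 2) q d =
        (W.reveal q.st).bind fun r => PMF.pure (r.1, ⟨r.2, q.queries, q.inserts, q.reveals + 1⟩) :=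
      rfl
    simp only [Prog.revealP, Prog.eval_pair', Prog.eval_seq', Prog.eval_fst', Prog.eval_snd',
      Prog.eval_call', PMF.pure_bind, hO 0, hW, Data.fst_cons, Data.snd_cons, Data.ofElems,
      List.map_cons, Data.ofList, zero_add]
  simp only [h, PMF.pure_bind, List.toFinset_cons, List.toFinset_nil, insert_empty_eq]
  rfl

section attack

variable {E : KeyedPerm} {c κ : ℕ} {p : Prog} {P : Polynomial ℕ}

/-- The probability that a query for the zero string is answered `1` by the revealed
representation. -/
theorem filicProb_reveal (hp : p.Evaluates E P) (W : World κ)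
    (rep : W.State → (keyStoringNY E (truncationBloom c)).Rep κ) (next : W.State → W.State)
    (hW : ∀ s, W.reveal s =
      PMF.pure ((keyStoringNY E (truncationBloom c)).encode κ (rep s), next s)) :
    filicProb W .tt Prog.revealP (Prog.queryP c p) =
      (((W.init {fun _ => false}).bind fun s =>
        (keyStoringNY E (truncationBloom c)).query κ (rep s) fun _ => false) true).toReal := by
  rw [filicProb, filicExperiment_reveal W _ next hW, PMF.map_bind]
  congr 3
  refine funext fun s => ?_
  have h := (Prog.queryP_yields hp c κ (rep s) fun _ => false).computes.1
  have h' := congrArg (PMF.map Data.isTrue) h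
  rw [PMF.map_comp, PMF.map_comp] at h'
  rw [PMF.map_comp]
  refine h'.trans ?_
  have : Data.isTrue ∘ Data.ofBool = id := funext Data.isTrue_ofBool
  rw [this, PMF.map_id]

theorem filicRun_reveal (hp : p.Evaluates E P) (W : World κ)
    (rep : W.State → (keyStoringNY E (truncationBloom c)).Rep κ) (next : W.State → W.State)
    (hW : ∀ s, W.reveal s =
      PMF.pure ((keyStoringNY E (truncationBloom c)).encode κ (rep s), next s))
    {qu qt qv ta td : ℕ} (hqv : 1 ≤ qv) (hta : 30 ≤ ta)
    (htd : (Prog.queryP c p).size + (P.eval κ + (Prog.cellP c).size + 31) ≤ td) :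
    ∀ r ∈ (filicExperiment W .tt Prog.revealP (Prog.queryP c p)).support,
      r.Within .tt Prog.revealP (Prog.queryP c p) qu qt qv ta td ∧
        ∃ s ∈ (W.init {fun _ => false}).support, r.final.st = next s := by
  intro r hr
  rw [filicExperiment_reveal W _ next hW, PMF.mem_support_bind_iff] at hr
  obtain ⟨s, hs, hr⟩ := hr
  rw [PMF.mem_support_map_iff] at hr
  obtain ⟨d, hd, rfl⟩ := hr
  have hd' := (Prog.queryP_yields hp c κ (rep s) fun _ => false).computes.2 d hd
  refine ⟨⟨?_, ?_, Nat.zero_le _, Nat.zero_le _, hqv⟩, s, hs, rfl⟩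
  · simp only [Prog.tt, Prog.revealP, Prog.size]
    omega
  · exact (Nat.add_le_add_left hd' _).trans htd

theorem real_prob : (((keyStoringNY E (truncationBloom c)).realWorld κ).init {fun _ => false}).bind
    (fun M => (keyStoringNY E (truncationBloom c)).query κ M fun _ => false) true = 1 := by
  have h := build_bind_query (E := E) c [fun _ : Fin κ => false] fun _ => false
  simp only [List.toFinset_cons, List.toFinset_nil, insert_empty_eq] at h
  refine (DFunLike.congr_fun h true).trans ?_
  have h (π : Equiv.Perm (Univ κ)) : isPositive c π [fun _ => false] (fun _ => false) = true := by
    simp [isPositive]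
  simp only [h, PMF.bind_const]
  exact PMF.pure_apply_self _

theorem ideal_prob (μ : PMF ((keyStoringNY E (truncationBloom c)).Aux κ)) :
    (((keyStoringNY E (truncationBloom c)).idealWorld κ μ).init {fun _ => false}).bind
      (fun s => (keyStoringNY E (truncationBloom c)).query κ (s.aux, s.arr) fun _ => false) true =
        ((2 : ℝ≥0∞) ^ c)⁻¹ := by
  have key (y : Univ κ) (f : Univ κ → Fin 1 → Fin (2 ^ c)) (arr : Fin (2 ^ c) → Bool)
      (harr : ∀ j, arr j = true ↔ f (fun _ => false) 0 = j) :
      (truncationBloom c).lookup κ arr y = decide (f (fun _ => false) =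
        fun _ => (⟨(Data.ofBits y).idx c, Data.idx_lt _ _⟩ : Fin (2 ^ c))) := by
    refine Bool.eq_iff_iff.2 ?_
    rw [decide_eq_true_iff, funext_iff, Fin.forall_fin_one]
    exact (decide_eq_true_iff.trans Fin.forall_fin_one).trans (harr _)
  have inner (y : Univ κ) (arr : (Univ κ → Fin 1 → Fin (2 ^ c)) → Fin (2 ^ c) → Bool)
      (harr : ∀ f j, arr f j = true ↔ f (fun _ => false) 0 = j) :
      ((PMF.uniformOfFintype (Univ κ → Fin 1 → Fin (2 ^ c))).bind fun f =>
        PMF.pure ((truncationBloom c).lookup κ (arr f) y)) true = ((2 : ℝ≥0∞) ^ c)⁻¹ := by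
    simp only [fun f => key y f (arr f) (harr f)]
    refine (prob_uniform_eval (fun _ => false) _).trans ?_
    simp
  simp only [InsertableFilter.idealWorld, PMF.monad_bind_eq_bind, PMF.monad_pure_eq_pure,
    PMF.bind_bind, PMF.pure_bind, query_apply]
  rw [PMF.bind_apply]
  refine (tsum_congr fun a => congrArg (μ a * ·)
    (inner (E κ a fun _ => false) _ fun f j => ?_)).trans ?_
  · refine Iff.trans (b := ∃ x ∈ ({fun _ => false} : Finset (Univ κ)), ∃ i, f x i = j)
      (@decide_eq_true_iff _ (_)) ?_
    simp only [Finset.mem_singleton, exists_eq_left]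
    exact Fin.exists_fin_one
  · rw [ENNReal.tsum_mul_right, μ.tsum_coe, one_mul]

theorem not_filicCorrect (hp : p.Evaluates E P) {δ : ℝ} (hδ : ((2 : ℝ) ^ c)⁻¹ < 1 - δ)
    {qu qt qv ta ts td : ℕ} (hqv : 1 ≤ qv) (hta : 30 ≤ ta) (hts : 2 * 2 ^ c + 3 ≤ ts)
    (htd : (Prog.queryP c p).size + (P.eval κ + (Prog.cellP c).size + 31) ≤ td) :
    ¬ (keyStoringNY E (truncationBloom c)).FilicCorrect κ qu qt qv ta ts td δ := by
  rintro ⟨μ, h⟩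
  let B := keyStoringNY E (truncationBloom c)
  have hreal (s : B.Rep κ) : (B.realWorld κ).reveal s = PMF.pure (B.encode κ s, s) := rfl
  let rep (s : (B.idealWorld κ μ).State) : B.Rep κ := (SimState.aux s, SimState.arr s)
  let next (s : (B.idealWorld κ μ).State) : (B.idealWorld κ μ).State :=
    { (s : SimState κ (B.len κ) (B.idx κ) (B.Aux κ)) with
      steps := SimState.steps s + B.len κ + 1 }
  have hideal (s : (B.idealWorld κ μ).State) : (B.idealWorld κ μ).reveal s =
    PMF.pure (B.encode κ (rep s), next s) := rfl
  have h' := h .tt Prog.revealP (Prog.queryP c p)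
    (fun r hr => (filicRun_reveal hp _ (fun s => s) _ hreal hqv hta htd r hr).1) fun r hr => by
      obtain ⟨hw, s, hs, hst⟩ :=
        filicRun_reveal hp _ rep next hideal hqv hta htd r hr
      refine ⟨hw, ?_⟩
      rw [hst]
      obtain ⟨a, _, hs⟩ := (PMF.mem_support_bind_iff _ _ _).1 hs
      obtain ⟨f, _, hs⟩ := (PMF.mem_support_bind_iff _ _ _).1 hs
      obtain rfl := (PMF.mem_support_pure_iff _ _).1 hs
      change 2 ^ c + ({fun _ => false} : Finset (Univ κ)).card * (1 + 1) + 2 ^ c + 1 ≤ ts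
      rw [Finset.card_singleton]
      omega
  rw [filicProb_reveal hp _ (fun s => s) _ hreal, filicProb_reveal hp _ rep next hideal,
    real_prob, ideal_prob] at h'
  have h₁ := (le_abs_self _).trans h'
  rw [ENNReal.toReal_one, ENNReal.toReal_inv, ENNReal.toReal_pow, ENNReal.toReal_ofNat] at h₁
  linarith

end attack

end

end

theorem mainTheorem6 (E : KeyedPerm) (hE : E.IsPRP) (n : ℕ) (hn : 1 ≤ n)
    (ε : ℝ) (hε₀ : 0 < ε) (hε₁ : ε < 1) (δ : ℝ) (hδ : δ < 1) :
    ∃ H : StandardBloom,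
      (keyStoringNY E H).IsBloom n ε ∧
      (∀ t : ℕ → ℕ, (∃ P : Polynomial ℕ, ∀ κ, t κ ≤ P.eval κ) →
        (keyStoringNY E H).ABResilient n t ε ∧ (keyStoringNY E H).BPResilient n t ε) ∧
      ∃ P : Polynomial ℕ, ∀ᶠ κ : ℕ in Filter.atTop, ∀ qu qt qv ta ts td : ℕ,
        1 ≤ qv → P.eval κ ≤ ta → P.eval κ ≤ ts → P.eval κ ≤ td →
          ¬ (keyStoringNY E H).FilicCorrect κ qu qt qv ta ts td δ := by
  obtain ⟨c, hs, hc, hcδ⟩ := ((eventually_sound (n := n) hE hε₀).and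
    ((((tendsto_pow_atTop_atTop_of_one_lt (one_lt_two (α := ℝ))).const_mul_atTop
        hε₀).eventually_ge_atTop (2 * (n : ℝ))).and
      ((tendsto_inv_atTop_zero.comp (tendsto_pow_atTop_atTop_of_one_lt
        (one_lt_two (α := ℝ)))).eventually_lt_const (sub_pos.2 hδ)))).exists
  obtain ⟨p, P, hp⟩ := hE.1
  refine ⟨truncationBloom c, isBloom c hE.1 hs, fun t ⟨Pt, hPt⟩ =>
      ⟨abResilient hE hε₀ hε₁ hc hPt, bpResilient hE hε₀ hε₁ hc hPt⟩,
    P + Polynomial.C ((Prog.queryP c p).size + (Prog.cellP c).size + 2 * 2 ^ c + 100),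
    Filter.Eventually.of_forall fun κ qu qt qv ta ts td hqv hta hts htd => ?_⟩
  rw [Polynomial.eval_add, Polynomial.eval_C] at hta hts htd
  exact not_filicCorrect hp hcδ hqv (by omega) (by omega) (by omega)
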